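/- An MV-algebra is an algebra $(N;\oplus,{}^*,0,1)$ such that $(N;\oplus,0)$ is a commutative monoid, $0^*=1$, $x^{**}=x$, $x\oplus 1=1$ and $x\oplus(x\oplus y^*)^*=y\oplus(y\oplus x^*)^*$; it is ordered by $x\le y\iff x^*\oplus y=1$. An EMV-algebra is an algebra $(M;\vee,\wedge,\oplus,0)$ such that $(M;\oplus,0)$ is a commutative monoid, $(M;\vee,\wedge,0)$ is a distributive lattice with bottom $0$, every element lies below an idempotent ($a\oplus a=a$), and for each idempotent $a$ the elements $\lambda_a(x)=\min\{z\in[0,a] : z\oplus x=a\}$ ($x\in[0,a]$) exist and $([0,a];\oplus,\lambda_a,0,a)$ is an MV-algebra. Every MV-algebra, and in particular $[0,1]$ with $x\oplus y=\min(x+y,1)$, is an EMV-algebra. An EMV-homomorphism is a map $f$ preserving $\vee,\wedge,\oplus,0$ with $f(\lambda_b(x))=\lambda_{f(b)}(f(x))$ for every idempotent $b$ and $x\in[0,b]$. A state-morphism on $M$ is an EMV-homomorphism $s:M\to[0,1]$ with $s(x)=1$ for some $x\in M$; the set $\mathcal{SM}(M)$ of state-morphisms carries the subspace topology of the product $[0,1]^M$.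 An ideal of $M$ is a non-empty subset closed downwards and under $\oplus$; the set $\mathrm{MaxI}(M)$ of maximal (proper) ideals carries the hull-kernel topology, whose open sets are $\{A\in\mathrm{MaxI}(M) : I\not\subseteq A\}$ for ideals $I$ of $M$. **Theorem.** Let $M$ be an EMV-algebra without top element, embedded by an injective EMV-homomorphism, regarded as an inclusion $M\subseteq N$, as a maximal ideal of an MV-algebra $N$ such that for every $x\in N$ either $x\in M$ or $x^*\in M$. Then: 1. $\mathcal{SM}(N)$ is the one-point compactification of $\mathcal{SM}(M)$: $\mathcal{SM}(M)$ is a non-compact locally compact Hausdorff space, $\mathcal{SM}(N)$ is compact Hausdorff, and there is a homeomorphism from $\mathcal{SM}(M)\cup\{\infty\}$ (the one-point compactification) onto $\mathcal{SM}(N)$ that sends $s\in\mathcal{SM}(M)$ to the state-morphism $\tilde s$ with $\tilde s(x)=s(x)$ and $\tilde s(x^*)=1-s(x)$ for $x\in M$, and sends $\infty$ to the state-morphism $s_\infty$ with $s_\infty(x)=0$ for $x\in M$ and $s_\infty(x)=1$ for $x\in N\setminus M$. 2. $\mathrm{MaxI}(N)$ is the one-point compactification of $\mathrm{MaxI}(M)$: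 $\mathrm{MaxI}(M)$ is a non-compact locally compact Hausdorff space, $\mathrm{MaxI}(N)$ is compact Hausdorff, and there is a homeomorphism from $\mathrm{MaxI}(M)\cup\{\infty\}$ (the one-point compactification) onto $\mathrm{MaxI}(N)$ that sends $J\in\mathrm{MaxI}(M)$ to a maximal ideal $K$ of $N$ with $K\cap M=J$, and sends $\infty$ to $M$. -/

import Mathlib

open Set Topology

/-- `S` with the operations `op`, `neg` and the constants `zero`, `one` (restricted to `S`)
is an MV-algebra. -/
structure IsMVAlgebraOn {α : Type*} (S : Set α) (op : α → α → α) (neg : α → α)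
    (zero one : α) : Prop where
  zero_mem : zero ∈ S
  one_mem : one ∈ S
  op_mem : ∀ x ∈ S, ∀ y ∈ S, op x y ∈ S
  neg_mem : ∀ x ∈ S, neg x ∈ S
  op_assoc : ∀ x ∈ S, ∀ y ∈ S, ∀ z ∈ S, op (op x y) z = op x (op y z)
  op_comm : ∀ x ∈ S, ∀ y ∈ S, op x y = op y x
  op_zero : ∀ x ∈ S, op x zero = x
  neg_zero : neg zero = one
  neg_neg : ∀ x ∈ S, neg (neg x) = x
  op_one : ∀ x ∈ S, op x one = one
  luk : ∀ x ∈ S, ∀ y ∈ S, op x (neg (op x (neg y))) = op y (neg (op y (neg x)))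

/-- MV-algebras; the operation `⊕` is written `+` and `x*` is written `xᶜ`. -/
class MVAlgebra (N : Type*) extends AddCommMonoid N, One N, Compl N where
  compl_zero : (0 : N)ᶜ = 1
  compl_compl : ∀ x : N, xᶜᶜ = x
  add_one : ∀ x : N, x + 1 = 1
  luk : ∀ x y : N, x + (x + yᶜ)ᶜ = y + (y + xᶜ)ᶜ

/-- `z = λ_b(x)`: `z` is the least element of `{z ∈ [0,b] ∣ z ⊕ x = b}`. -/
def IsRelCompl {M : Type*} [Add M] [Zero M] [LE M] (b x z : M) : Prop :=
  IsLeast {z : M | (0 ≤ z ∧ z ≤ b) ∧ z + x = b} z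

/-- EMV-algebras; the operation `⊕` is written `+`. -/
class EMVAlgebra (M : Type*) extends AddCommMonoid M, DistribLattice M where
  zero_le' : ∀ x : M, 0 ≤ x
  interval_mv : ∀ a : M, a + a = a → ∃ lam : M → M,
    (∀ x ∈ Icc 0 a, IsRelCompl a x (lam x)) ∧
      IsMVAlgebraOn (Icc 0 a) (fun x y => x + y) lam 0 a
  exists_idempotent_ge : ∀ x : M, ∃ a : M, a + a = a ∧ x ≤ a

namespace MVAlgebra

variable {N : Type*} [MVAlgebra N]

theorem compl_one : (1 : N)ᶜ = 0 := by
  rw [← compl_zero, compl_compl]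

theorem add_compl (x : N) : x + xᶜ = 1 := by
  have h := luk x 1
  rwa [compl_one, add_zero, add_comm 1, add_one] at h

/-- The natural order of an MV-algebra: `x ≤ y` iff `x* ⊕ y = 1`. -/
def Le (x y : N) : Prop := xᶜ + y = 1

theorem le_add (x z : N) : Le x (x + z) := by
  unfold Le
  rw [← add_assoc, add_comm xᶜ, add_compl, add_comm, add_one]

theorem Le.eq {x y : N} (h : Le x y) : x + (x + yᶜ)ᶜ = y := by
  rw [luk, add_comm y xᶜ, h, compl_one, add_zero]

theorem Le.add_left {x y : N} (h : Le x y) (z : N) : Le (z + x) (z + y) := by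
  rw [← h.eq, ← add_assoc]
  exact le_add _ _

theorem Le.compl {x y : N} (h : Le x y) : Le yᶜ xᶜ := by
  unfold Le at *
  rw [compl_compl, add_comm, h]

theorem Le.trans {x y z : N} (h : Le x y) (h' : Le y z) : Le x z := by
  rw [← h'.eq, ← h.eq, add_assoc]
  exact le_add _ _

theorem Le.sup {x y z : N} (h : Le x z) (h' : Le y z) : Le (x + (x + yᶜ)ᶜ) z := by
  have := ((h'.compl.add_left x).compl).add_left x
  rwa [h.eq] at this

/-- The natural order with `x ∨ y = x ⊕ (x ⊕ y*)*` (that is, `(y ⊖ x) ⊕ x`)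
and `x ∧ y = (x* ∨ y*)*`. -/
instance (priority := 100) toLattice : Lattice N where
  le := Le
  sup x y := x + (x + yᶜ)ᶜ
  inf x y := (xᶜ + (xᶜ + yᶜᶜ)ᶜ)ᶜ
  le_refl x := by
    change xᶜ + x = 1
    rw [add_comm, add_compl]
  le_trans _ _ _ := Le.trans
  le_antisymm x y h h' := by
    rw [← Le.eq h, add_comm x yᶜ, (h' : yᶜ + x = 1), compl_one, add_zero]
  le_sup_left x y := le_add _ _
  le_sup_right x y := by
    rw [luk]
    exact le_add _ _
  sup_le _ _ _ := Le.sup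
  inf_le_left x y := by
    have := (le_add xᶜ (xᶜ + yᶜᶜ)ᶜ).compl
    rwa [compl_compl x] at this
  inf_le_right x y := by
    rw [luk xᶜ yᶜ]
    have := (le_add yᶜ (yᶜ + xᶜᶜ)ᶜ).compl
    rwa [compl_compl y] at this
  le_inf x y z h h' := by
    have := (Le.sup (Le.compl h) (Le.compl h')).compl
    rwa [compl_compl x] at this

theorem le_def {x y : N} : x ≤ y ↔ xᶜ + y = 1 := Iff.rfl

theorem sup_def (x y : N) : x ⊔ y = x + (x + yᶜ)ᶜ := rfl

theorem inf_def (x y : N) : x ⊓ y = (xᶜ ⊔ yᶜ)ᶜ := rfl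

theorem compl_anti {x y : N} (h : x ≤ y) : yᶜ ≤ xᶜ := Le.compl h

theorem add_mono {x y z w : N} (h : x ≤ y) (h' : z ≤ w) : x + z ≤ y + w := by
  have h1 : x + z ≤ x + w := Le.add_left h' x
  have h2 : w + x ≤ w + y := Le.add_left h w
  rw [add_comm w, add_comm w] at h2
  exact h1.trans h2

theorem inf_eq (x y : N) : x ⊓ y = (xᶜ + (xᶜ + y)ᶜ)ᶜ := by
  rw [inf_def, sup_def, compl_compl]

/-- Every MV-algebra is an EMV-algebra. -/
instance (priority := 100) toEMVAlgebra : EMVAlgebra N where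
  __ := DistribLattice.ofInfSupLe (α := N) (by
    intro x y z
    have key : ∀ u : N, u ≤ y ⊔ z → (uᶜ + ((y ⊔ z)ᶜ + x)ᶜ)ᶜ ≤ x ⊓ u := by
      intro u hu
      rw [inf_comm, inf_eq]
      exact compl_anti (add_mono le_rfl (compl_anti (add_mono (compl_anti hu) le_rfl)))
    have adj : ∀ u v w : N, (uᶜ + vᶜ)ᶜ ≤ w ↔ u ≤ vᶜ + w := by
      intro u v w
      rw [le_def, le_def, compl_compl, add_assoc]
    rw [inf_comm, inf_eq, adj]
    refine sup_le ?_ ?_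
    · exact (adj _ _ _).1 ((key y le_sup_left).trans le_sup_left)
    · exact (adj _ _ _).1 ((key z le_sup_right).trans le_sup_right))
  zero_le' x := by
    rw [le_def, compl_zero, add_comm, add_one]
  interval_mv a ha := by
    have zle : ∀ x : N, 0 ≤ x := fun x => by
      rw [le_def, compl_zero, add_comm, add_one]
    have hself : ∀ x y : N, x ≤ x + y := fun x y => le_add x y
    have hlam : ∀ y ≤ a, (y + aᶜ)ᶜ + aᶜ = yᶜ := by
      intro y hy
      have : aᶜ ⊔ yᶜ = yᶜ := sup_eq_right.2 (compl_anti hy)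
      rw [sup_def, compl_compl] at this
      rw [add_comm, add_comm y, this]
    have hmem : ∀ x : N, (x + aᶜ)ᶜ ≤ a := by
      intro x
      have := compl_anti (hself aᶜ x)
      rwa [compl_compl, add_comm] at this
    refine ⟨fun x => (x + aᶜ)ᶜ, ?_, ?_⟩
    · rintro x ⟨-, hx⟩
      refine ⟨⟨⟨zle _, hmem x⟩, ?_⟩, ?_⟩
      · rw [add_comm]
        exact sup_eq_right.2 hx
      · rintro z ⟨-, hz⟩
        change (x + aᶜ)ᶜ ≤ z
        rw [le_def, compl_compl, add_right_comm, add_comm x, hz, add_compl]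
    · refine ⟨⟨le_rfl, zle _⟩, ⟨zle _, le_rfl⟩, ?_, ?_, ?_, ?_, ?_, ?_, ?_, ?_, ?_⟩
      · rintro x ⟨-, hx⟩ y ⟨-, hy⟩
        refine ⟨zle _, ?_⟩
        have := add_mono hx hy
        rwa [ha] at this
      · exact fun x _ => ⟨zle _, hmem x⟩
      · exact fun x _ y _ z _ => add_assoc x y z
      · exact fun x _ y _ => add_comm x y
      · exact fun x _ => add_zero x
      · change (0 + aᶜ)ᶜ = a
        rw [zero_add, compl_compl]
      · rintro x ⟨-, hx⟩
        rw [hlam x hx, compl_compl]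
      · rintro x ⟨-, hx⟩
        refine le_antisymm ?_ ?_
        · have := add_mono hx (le_refl a)
          rwa [ha] at this
        · have := hself a x
          rwa [add_comm] at this
      · rintro x ⟨-, hx⟩ y ⟨-, hy⟩
        change x + ((x + (y + aᶜ)ᶜ) + aᶜ)ᶜ = y + ((y + (x + aᶜ)ᶜ) + aᶜ)ᶜ
        rw [add_assoc x, add_assoc y, hlam y hy, hlam x hx, luk]
  exists_idempotent_ge x := ⟨1, add_one 1, by
    rw [le_def, add_one]⟩

end MVAlgebra

/-- Truncated addition `min (x + y) 1` on the real unit interval. -/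
noncomputable instance unitInterval.truncAdd : Add unitInterval where
  add x y := ⟨min ((x : ℝ) + y) 1, le_min (add_nonneg x.2.1 y.2.1) zero_le_one, min_le_right _ _⟩

theorem unitInterval.coe_truncAdd (x y : unitInterval) :
    ((x + y : unitInterval) : ℝ) = min ((x : ℝ) + y) 1 := rfl

noncomputable instance unitInterval.truncAddCommMonoid : AddCommMonoid unitInterval where
  add_assoc x y z := by
    apply Subtype.ext
    simp only [unitInterval.coe_truncAdd]
    have := x.2.1
    have := z.2.1
    rcases le_total ((x : ℝ) + y) 1 with h | h <;> rcases le_total ((y : ℝ) + z) 1 with h' | h' <;>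
      simp only [min_eq_left h, min_eq_right h, min_eq_left h', min_eq_right h']
    · rw [add_assoc]
    all_goals rw [min_eq_right (by linarith), min_eq_right (by linarith)]
  zero_add x := Subtype.ext (by
    change min (0 + (x : ℝ)) 1 = x
    rw [zero_add, min_eq_left x.2.2])
  add_zero x := Subtype.ext (by
    change min ((x : ℝ) + 0) 1 = x
    rw [add_zero, min_eq_left x.2.2])
  add_comm x y := Subtype.ext (by
    change min ((x : ℝ) + y) 1 = min ((y : ℝ) + x) 1
    rw [add_comm])
  nsmul := nsmulRec

/-- The EMV-algebra of the real interval `[0,1]`, with its usual order. -/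
noncomputable instance unitInterval.emvAlgebra : EMVAlgebra unitInterval where
  zero_le' x := x.2.1
  interval_mv a ha := by
    have ha' : min ((a : ℝ) + a) 1 = a := congrArg Subtype.val ha
    have h0 := a.2.1
    have h1 := a.2.2
    have hcases : (a : ℝ) = 0 ∨ (a : ℝ) = 1 := by
      rcases le_total ((a : ℝ) + a) 1 with h | h
      · rw [min_eq_left h] at ha'
        left
        linarith
      · rw [min_eq_right h] at ha'
        exact Or.inr ha'.symm
    have addz : ∀ x y : unitInterval, x ≤ a → y ≤ a →
        ((x + y : unitInterval) : ℝ) = min ((x : ℝ) + y) a := by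
      intro x y hx hy
      rw [unitInterval.coe_truncAdd]
      have hx' : (x : ℝ) ≤ a := hx
      have hy' : (y : ℝ) ≤ a := hy
      rcases hcases with h | h
      · rw [h] at hx' hy' ⊢
        have := x.2.1
        have := y.2.1
        rw [min_eq_left (by linarith), min_eq_left (by linarith)]
      · rw [h]
    let lam : unitInterval → unitInterval := fun x =>
      ⟨max ((a : ℝ) - x) 0, le_max_right _ _, max_le (by linarith [x.2.1]) zero_le_one⟩
    have lamz : ∀ x : unitInterval, x ≤ a → ((lam x : unitInterval) : ℝ) = a - x := by
      intro x hx
      have hx' : (x : ℝ) ≤ a := hx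
      exact max_eq_left (by linarith)
    have lamle : ∀ x : unitInterval, lam x ≤ a := by
      intro x
      change max ((a : ℝ) - x) 0 ≤ a
      exact max_le (by linarith [x.2.1]) h0
    have addle : ∀ x y : unitInterval, x ≤ a → y ≤ a → x + y ≤ a := by
      intro x y hx hy
      change ((x + y : unitInterval) : ℝ) ≤ a
      rw [addz x y hx hy]
      exact min_le_right _ _
    have zle : ∀ x : unitInterval, (0 : unitInterval) ≤ x := fun x => x.2.1
    refine ⟨lam, ?_, ?_⟩
    · rintro x ⟨-, hx⟩
      refine ⟨⟨⟨zle _, lamle x⟩, ?_⟩, ?_⟩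
      · apply Subtype.ext
        rw [addz _ _ (lamle x) hx, lamz x hx, sub_add_cancel, min_self]
      · rintro z ⟨⟨-, hz⟩, hzx⟩
        have h2 : ((z + x : unitInterval) : ℝ) = a := congrArg Subtype.val hzx
        rw [addz _ _ hz hx] at h2
        change ((lam x : unitInterval) : ℝ) ≤ z
        rw [lamz x hx]
        have := min_le_left ((z : ℝ) + x) a
        linarith
    · refine ⟨⟨le_rfl, zle _⟩, ⟨zle _, le_rfl⟩, ?_, ?_, ?_, ?_, ?_, ?_, ?_, ?_, ?_⟩
      · exact fun x hx y hy => ⟨zle _, addle x y hx.2 hy.2⟩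
      · exact fun x _ => ⟨zle _, lamle x⟩
      · exact fun x _ y _ z _ => add_assoc x y z
      · exact fun x _ y _ => add_comm x y
      · exact fun x _ => add_zero x
      · apply Subtype.ext
        rw [lamz 0 (zle a)]
        exact sub_zero _
      · rintro x ⟨-, hx⟩
        apply Subtype.ext
        rw [lamz _ (lamle x), lamz x hx]
        ring
      · rintro x ⟨-, hx⟩
        apply Subtype.ext
        rw [addz x a hx le_rfl]
        exact min_eq_right (by linarith [x.2.1])
      · rintro x ⟨-, hx⟩ y ⟨-, hy⟩
        apply Subtype.ext
        change ((x + lam (x + lam y) : unitInterval) : ℝ) = (y + lam (y + lam x) : unitInterval)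
        rw [addz _ _ hx (lamle _), addz _ _ hy (lamle _),
          lamz _ (addle _ _ hx (lamle _)), lamz _ (addle _ _ hy (lamle _)),
          addz _ _ hx (lamle _), addz _ _ hy (lamle _), lamz _ hx, lamz _ hy]
        have hx' : (x : ℝ) ≤ a := hx
        have hy' : (y : ℝ) ≤ a := hy
        rcases le_total (x : ℝ) y with h | h
        · rw [min_eq_left (by linarith : (x : ℝ) + (a - y) ≤ a),
            min_eq_right (by linarith : (a : ℝ) ≤ y + (a - x))]
          congr 1
          ring
        · rw [min_eq_right (by linarith : (a : ℝ) ≤ x + (a - y)),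
            min_eq_left (by linarith : (y : ℝ) + (a - x) ≤ a)]
          congr 1
          ring
  exists_idempotent_ge x := ⟨1, Subtype.ext (by
    rw [unitInterval.coe_truncAdd]
    change min ((1 : ℝ) + 1) 1 = 1
    norm_num), x.2.2⟩

/-- EMV-homomorphisms. -/
structure IsEMVHom {M₁ M₂ : Type*} [EMVAlgebra M₁] [EMVAlgebra M₂] (f : M₁ → M₂) : Prop where
  map_sup : ∀ x y, f (x ⊔ y) = f x ⊔ f y
  map_inf : ∀ x y, f (x ⊓ y) = f x ⊓ f y
  map_add : ∀ x y, f (x + y) = f x + f y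
  map_zero : f 0 = 0
  map_relCompl : ∀ b x z, b + b = b → x ∈ Icc 0 b → IsRelCompl b x z →
    IsRelCompl (f b) (f x) (f z)

section EMV

variable (M : Type*) [EMVAlgebra M]

/-- The set of state-morphisms on `M`. -/
def StateMorphism : Type _ :=
  {s : M → unitInterval // IsEMVHom s ∧ ∃ x, s x = 1}

noncomputable instance : CoeFun (StateMorphism M) (fun _ => M → unitInterval) := ⟨fun s => s.1⟩

/-- The weak topology of state-morphisms, i.e. the subspace topology of the product topology
of `[0,1]^M`. -/
noncomputable instance : TopologicalSpace (StateMorphism M) :=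
  inferInstanceAs (TopologicalSpace {s : M → unitInterval // IsEMVHom s ∧ ∃ x, s x = 1})

variable {M}

/-- Ideals of an EMV-algebra. -/
structure IsEMVIdeal (I : Set M) : Prop where
  nonempty : I.Nonempty
  mem_of_le : ∀ x y, x ≤ y → y ∈ I → x ∈ I
  add_mem : ∀ x y, x ∈ I → y ∈ I → x + y ∈ I

/-- Maximal ideals: the proper ideals that are contained in no other proper ideal. -/
structure IsMaximalEMVIdeal (I : Set M) : Prop where
  isEMVIdeal : IsEMVIdeal I
  ne_univ : I ≠ univ
  eq_of_subset : ∀ J : Set M, IsEMVIdeal J → J ≠ univ → I ⊆ J → J = I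

variable (M)

/-- The set `MaxI(M)` of maximal ideals. -/
structure MaxI where
  carrier : Set M
  isMaximal : IsMaximalEMVIdeal carrier

/-- The hull-kernel topology on `MaxI(M)`: the open sets are the sets
`O(I) = {A ∈ MaxI(M) ∣ I ⊄ A}` for ideals `I` of `M`. -/
instance : TopologicalSpace (MaxI M) :=
  TopologicalSpace.generateFrom
    {U | ∃ I : Set M, IsEMVIdeal I ∧ U = {A : MaxI M | ¬ I ⊆ A.carrier}}

end EMV

/-! Both halves rest on one topological fact: if `Y` is compact Hausdorff and `X` embeds in `Y` with
range the complement of a point, then `Y` is the one-point compactification of `X`, and `X` is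
locally compact Hausdorff. The embeddings here extend states and maximal ideals from `M` to `N`; the
omitted points are the two-valued state vanishing exactly on `M`, and `M` itself.

Extension is localization at an idempotent. For an idempotent `b` of `M`, the map `y ↦ y ⊓ b`
respects `⊕` and carries complements to relative complements in `[0,b]`, which lies in `M` because
`M` is an ideal. A state `s` with `s b = 1` extends by `y ↦ s (y ⊓ b)`, a maximal ideal `J` with `b
∉ J` by `{y | y ⊓ b ∈ J}`.

States of `N` are cut out of the cube by equations, so they form a compact set. `MaxI N` is its
continuous image under `s ↦ ker s`. Surjectivity is the deepest step: the quotient by a maximal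
ideal is a nontrivial MV-chain, and every such chain has a homomorphism to `[0,1]`, given by binary
expansion.

Noncompactness comes from the directed open cover by the sets "`b ∉ J`" (or "`s b ≠ 0`"), `b`
idempotent; as `M` has no top, no member is the whole space. -/

namespace MVAlgebra

variable {N : Type*} [MVAlgebra N]

/-! ### MV-algebra arithmetic: residuation, partial addition, idempotents. Throughout, `(xᶜ + y)ᶜ`
is the truncated difference `x ⊖ y`. -/

theorem zero_le (x : N) : 0 ≤ x := by
  rw [le_def, compl_zero, add_comm, add_one]

theorem le_one (x : N) : x ≤ 1 := by
  rw [le_def, add_one]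

theorem le_self_add (x y : N) : x ≤ x + y := le_add x y

theorem le_add_self (x y : N) : x ≤ y + x := add_comm x y ▸ le_add x y

theorem compl_le_comm {x y : N} : xᶜ ≤ y ↔ yᶜ ≤ x := by
  rw [le_def, le_def, compl_compl, compl_compl, add_comm]

theorem le_compl_comm {x y : N} : x ≤ yᶜ ↔ y ≤ xᶜ := by
  rw [le_def, le_def, add_comm]

theorem compl_injective : Function.Injective (compl : N → N) := fun x y h => by
  rw [← compl_compl x, h, compl_compl]

/-- Truncated subtraction is residuated. -/
theorem tsub_le_iff {x y z : N} : (xᶜ + y)ᶜ ≤ z ↔ x ≤ y + z := by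
  rw [le_def, le_def, compl_compl, add_assoc]

theorem add_compl_add {x y : N} (h : x ≤ y) : x + (x + yᶜ)ᶜ = y := Le.eq h

theorem add_compl_add_compl {x y : N} (h : x ≤ yᶜ) : x + (x + y)ᶜ = yᶜ := by
  have := add_compl_add h
  rwa [compl_compl] at this

theorem add_inf' (x y z : N) : x + (y ⊓ z) = (x + y) ⊓ (x + z) := by
  refine le_antisymm (le_inf (add_mono le_rfl inf_le_left) (add_mono le_rfl inf_le_right)) ?_
  rw [← tsub_le_iff]
  exact le_inf (tsub_le_iff.2 inf_le_left) (tsub_le_iff.2 inf_le_right)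

theorem inf_add_inf (x y z w : N) :
    (x ⊓ y) + (z ⊓ w) = ((x + z) ⊓ (y + z)) ⊓ ((x + w) ⊓ (y + w)) := by
  rw [add_inf', add_comm _ z, add_comm _ w, add_inf', add_inf', add_comm z, add_comm z, add_comm w,
    add_comm w]

theorem inf_add_le (v x y : N) : v ⊓ (x + y) ≤ (v ⊓ x) + (v ⊓ y) := by
  rw [inf_add_inf]
  refine le_inf (le_inf ?_ ?_) (le_inf ?_ ?_)
  · exact inf_le_left.trans (le_self_add _ _)
  · exact inf_le_left.trans (le_add_self _ _)
  · exact inf_le_left.trans (le_self_add _ _)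
  · exact inf_le_right

/-- By subadditivity of `v ⊓ ·`. This is what makes maximal ideals prime. -/
theorem inf_nsmul_eq_zero {u v : N} (h : v ⊓ u = 0) (n : ℕ) : v ⊓ n • u = 0 := by
  refine le_antisymm ?_ (zero_le _)
  induction n with
  | zero => rw [zero_nsmul]; exact inf_le_right
  | succ n ih =>
    rw [succ_nsmul]
    refine (inf_add_le _ _ _).trans ?_
    rw [h, add_zero]
    exact ih

/-- An untruncated sum determines its summand: `x + (x + y)ᶜ` recovers `yᶜ`. -/
theorem add_left_cancel' {x y z : N} (hy : x ≤ yᶜ) (hz : x ≤ zᶜ) (h : x + y = x + z) : y = z := by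
  apply compl_injective
  rw [← add_compl_add_compl hy, ← add_compl_add_compl hz, h]

/-- Associativity of the partial addition, defined when `x ≤ yᶜ`, that is, when no truncation
occurs. -/
theorem orthogonal_assoc {x y z : N} (h : x ≤ yᶜ) (h' : x + y ≤ zᶜ) : y + z ≤ xᶜ := by
  have := add_compl_add_compl (le_compl_comm.1 h)
  rw [← this]
  refine add_mono le_rfl ?_
  rw [add_comm y x]
  exact le_compl_comm.1 h'

/-- Adding `x ⊓ y` to the two differences gives `x` and `y`. Addition distributes over meets, so
adding `x ⊓ y` to their meet gives `x ⊓ y` back, and cancellation leaves `0`. -/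
theorem tsub_inf_tsub (x y : N) : (xᶜ + y)ᶜ ⊓ (yᶜ + x)ᶜ = 0 := by
  have e1 : xᶜ + y = x ⊓ y + xᶜ := by
    rw [add_comm _ xᶜ, add_inf', add_comm xᶜ x, add_compl, inf_eq_right.2 (le_one _)]
  have e2 : yᶜ + x = x ⊓ y + yᶜ := by
    rw [add_comm _ yᶜ, add_inf', add_comm yᶜ y, add_compl, inf_eq_left.2 (le_one _)]
  have h1 : x ⊓ y + (xᶜ + y)ᶜ = x := by rw [e1]; exact add_compl_add inf_le_left
  have h2 : x ⊓ y + (yᶜ + x)ᶜ = y := by rw [e2]; exact add_compl_add inf_le_right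
  refine add_left_cancel' (x := x ⊓ y) ?_ ?_ ?_
  · refine le_compl_comm.1 (inf_le_left.trans ?_)
    rw [e1]
    exact compl_anti (le_self_add _ _)
  · rw [compl_zero]; exact le_one _
  · rw [add_inf', h1, h2, add_zero]

theorem add_eq_of_idempotent_le {a v : N} (ha : a + a = a) (h : a ≤ v) : a + v = v := by
  rw [← add_compl_add h, ← add_assoc, ha]

theorem sup_compl_of_idempotent {b : N} (hb : b + b = b) : b ⊔ bᶜ = 1 := by
  rw [sup_def, compl_compl, hb, add_compl]

theorem compl_idempotent {b : N} (hb : b + b = b) : bᶜ + bᶜ = bᶜ := by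
  refine le_antisymm ?_ (le_self_add _ _)
  have h : b ⊔ bᶜ = 1 := sup_compl_of_idempotent hb
  rw [le_def, add_comm]
  rw [sup_comm, sup_def] at h
  exact h

theorem inf_compl_of_idempotent {b : N} (hb : b + b = b) : bᶜ ⊓ b = 0 := by
  rw [inf_def, compl_compl, sup_compl_of_idempotent hb, compl_one]

theorem add_inf_of_idempotent {b : N} (hb : b + b = b) (x y : N) :
    (x + y) ⊓ b = (x ⊓ b) + (y ⊓ b) := by
  refine le_antisymm ?_ ?_
  · rw [inf_comm, inf_comm x, inf_comm y]
    exact inf_add_le _ _ _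
  · refine le_inf (add_mono inf_le_left inf_le_left) ?_
    calc x ⊓ b + y ⊓ b ≤ b + b := add_mono inf_le_right inf_le_right
      _ = b := hb

/-- With `add_inf_of_idempotent`, this makes `y ↦ y ⊓ b` a homomorphism onto the MV-algebra `[0,b]`:
the right side is the complement of `y ⊓ b` relative to `b`. -/
theorem compl_inf_of_idempotent {b : N} (hb : b + b = b) (y : N) :
    yᶜ ⊓ b = (y ⊓ b + bᶜ)ᶜ := by
  have e : y ⊓ b + bᶜ = bᶜ + y := by
    rw [add_comm, add_inf', add_comm bᶜ b, add_compl, inf_eq_left.2 (le_one _)]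
  rw [e]
  refine le_antisymm ?_ (le_inf (compl_anti (le_add_self _ _)) ?_)
  · rw [le_compl_comm]
    have h : bᶜ ≤ (yᶜ ⊓ b)ᶜ := compl_anti inf_le_right
    rw [← add_eq_of_idempotent_le (compl_idempotent hb) h]
    exact add_mono le_rfl (le_compl_comm.1 inf_le_left)
  · rw [compl_le_comm]
    exact le_self_add _ _

theorem isRelCompl_compl {b x : N} (h : x ≤ b) : IsRelCompl b x (x + bᶜ)ᶜ := by
  refine ⟨⟨⟨zero_le _, ?_⟩, ?_⟩, ?_⟩
  · exact compl_le_comm.1 (le_add_self bᶜ x)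
  · rw [add_comm]
    exact add_compl_add h
  · rintro z ⟨-, hz⟩
    rw [add_comm x]
    refine tsub_le_iff.2 ?_
    rw [add_comm x, hz]

theorem isRelCompl_iff {b x z : N} (h : x ≤ b) : IsRelCompl b x z ↔ z = (x + bᶜ)ᶜ :=
  ⟨fun hz => hz.unique (isRelCompl_compl h), fun hz => hz ▸ isRelCompl_compl h⟩

end MVAlgebra

namespace MVAlgebra

/-! ### Binary expansion in an MV-chain -/

section Chain

variable {C : Type*} [MVAlgebra C]

open Classical in
/-- The leading binary digit of an element of an MV-chain. -/
noncomputable def digit (x : C) : ℝ := if xᶜ ≤ x then 1 else 0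

open Classical in
/-- Doubling modulo one in an MV-chain. -/
noncomputable def double (x : C) : C := if xᶜ ≤ x then (xᶜ + xᶜ)ᶜ else x + x

/-- The real number whose binary digits are obtained by iterated doubling. -/
noncomputable def binaryValue (x : C) : ℝ :=
  ∑' n : ℕ, digit (double^[n] x) * (1 / 2) ^ (n + 1)

theorem digit_nonneg (x : C) : 0 ≤ digit x := by
  unfold digit; split_ifs <;> norm_num

theorem digit_le_one (x : C) : digit x ≤ 1 := by
  unfold digit; split_ifs <;> norm_num

theorem hasSum_half_pow : HasSum (fun n : ℕ => ((1 : ℝ) / 2) ^ (n + 1)) 1 := by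
  have := hasSum_geometric_two.mul_right ((1 : ℝ) / 2)
  norm_num at this
  simpa only [pow_succ, one_div] using this

theorem summable_binaryValue (x : C) :
    Summable fun n : ℕ => digit (double^[n] x) * ((1 : ℝ) / 2) ^ (n + 1) :=
  Summable.of_nonneg_of_le (fun _ => mul_nonneg (digit_nonneg _) (by positivity))
    (fun _ => mul_le_of_le_one_left (by positivity) (digit_le_one _)) hasSum_half_pow.summable

theorem binaryValue_nonneg (x : C) : 0 ≤ binaryValue x :=
  tsum_nonneg fun _ => mul_nonneg (digit_nonneg _) (by positivity)

theorem binaryValue_le_one (x : C) : binaryValue x ≤ 1 := by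
  rw [← hasSum_half_pow.tsum_eq]
  exact (summable_binaryValue x).tsum_le_tsum
    (fun _ => mul_le_of_le_one_left (by positivity) (digit_le_one _)) hasSum_half_pow.summable

theorem two_mul_binaryValue (x : C) : 2 * binaryValue x = digit x + binaryValue (double x) := by
  have h : binaryValue x = _ := (summable_binaryValue x).tsum_eq_zero_add
  have h' : (∑' n : ℕ, digit (double^[n + 1] x) * ((1 : ℝ) / 2) ^ (n + 1 + 1)) =
      binaryValue (double x) * (1 / 2) := by
    rw [binaryValue, ← tsum_mul_right]
    refine tsum_congr fun n => ?_
    rw [Function.iterate_succ_apply, pow_succ _ (n + 1), mul_assoc]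
  rw [h, h', Function.iterate_zero_apply]
  ring

theorem two_mul_binaryValue_of_compl_le {x : C} (h : xᶜ ≤ x) :
    2 * binaryValue x = 1 + binaryValue (xᶜ + xᶜ)ᶜ := by
  rw [two_mul_binaryValue, digit, double, if_pos h, if_pos h]

theorem two_mul_binaryValue_of_not {x : C} (h : ¬ xᶜ ≤ x) :
    2 * binaryValue x = binaryValue (x + x) := by
  rw [two_mul_binaryValue, digit, double, if_neg h, if_neg h, zero_add]

theorem binaryValue_one : binaryValue (1 : C) = 1 := by
  have h := two_mul_binaryValue_of_compl_le (le_one (1 : C)ᶜ)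
  rw [compl_one, add_zero, compl_zero] at h
  linarith

theorem binaryValue_zero (h01 : (0 : C) ≠ 1) : binaryValue (0 : C) = 0 := by
  have h : ¬ (0 : C)ᶜ ≤ 0 := fun h => by
    rw [compl_zero] at h
    exact h01 (le_antisymm (zero_le _) h)
  have h := two_mul_binaryValue_of_not h
  rw [add_zero] at h
  linarith

/-- Used with `r` the failure of an identity for `binaryValue`: one doubling step expresses the
failure, up to sign, as half of another failure of the same kind, so every bound can be halved
again. -/
theorem eq_zero_of_abs_le_half_pow {r : ℝ} (h : ∀ n : ℕ, |r| ≤ 2 * (1 / 2) ^ n) : r = 0 := by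
  have ht : Filter.Tendsto (fun n : ℕ => 2 * ((1 : ℝ) / 2) ^ n) Filter.atTop (𝓝 (2 * 0)) :=
    (tendsto_pow_atTop_nhds_zero_of_lt_one (by norm_num) (by norm_num)).const_mul 2
  rw [mul_zero] at ht
  exact abs_nonpos_iff.1 (ge_of_tendsto' ht h)

theorem binaryValue_compl (htot : ∀ x y : C, x ≤ y ∨ y ≤ x) (h01 : (0 : C) ≠ 1) (x : C) :
    binaryValue xᶜ = 1 - binaryValue x := by
  have key : ∀ (n : ℕ) (x : C), |binaryValue x + binaryValue xᶜ - 1| ≤ 2 * (1 / 2) ^ n := by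
    intro n
    induction n with
    | zero =>
      intro x
      have := binaryValue_nonneg x
      have := binaryValue_le_one x
      have := binaryValue_nonneg xᶜ
      have := binaryValue_le_one xᶜ
      rw [abs_le]
      constructor <;> norm_num <;> linarith
    | succ n ih =>
      intro x
      by_cases h : xᶜ ≤ x <;> by_cases h' : x ≤ xᶜ
      -- Here `x` is exactly one half: both `x` and `xᶜ` have digit `1`, so the value is computed
      -- directly.
      · have hx : xᶜ = x := le_antisymm h h'
        have e := two_mul_binaryValue_of_compl_le h
        have e2 : (xᶜ + xᶜ)ᶜ = 0 := by
          nth_rewrite 2 [hx]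
          rw [add_comm, add_compl, compl_one]
        rw [e2, binaryValue_zero h01] at e
        rw [hx, show binaryValue x + binaryValue x - 1 = 0 by linarith, abs_zero]
        positivity
      · have e := two_mul_binaryValue_of_compl_le h
        have e' := two_mul_binaryValue_of_not (x := xᶜ) (by rwa [compl_compl])
        have := ih (xᶜ + xᶜ)
        rw [show binaryValue x + binaryValue xᶜ - 1 =
          (binaryValue (xᶜ + xᶜ) + binaryValue (xᶜ + xᶜ)ᶜ - 1) * (1 / 2) by linarith, abs_mul,
          pow_succ, ← mul_assoc, abs_of_pos (by norm_num : (0 : ℝ) < 1 / 2)]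
        gcongr
      · have e := two_mul_binaryValue_of_not h
        have e' := two_mul_binaryValue_of_compl_le (x := xᶜ) (by rwa [compl_compl])
        rw [compl_compl] at e'
        have := ih (x + x)
        rw [show binaryValue x + binaryValue xᶜ - 1 =
          (binaryValue (x + x) + binaryValue (x + x)ᶜ - 1) * (1 / 2) by linarith, abs_mul,
          pow_succ, ← mul_assoc, abs_of_pos (by norm_num : (0 : ℝ) < 1 / 2)]
        gcongr
      · exact absurd ((htot x xᶜ).resolve_left h') h
  have := eq_zero_of_abs_le_half_pow fun n => key n x
  linarith

end Chain

/-! ### Additivity of the binary value, through triples with untruncated sum one -/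

section Triple

variable {C : Type*} [MVAlgebra C]

/-- Three elements whose sum is `1` without truncation. -/
structure IsUnitTriple (x y w : C) : Prop where
  orthogonal : x ≤ yᶜ
  eq_compl : w = (x + y)ᶜ

namespace IsUnitTriple

variable {x y w : C}

theorem swap (h : IsUnitTriple x y w) : IsUnitTriple y x w :=
  ⟨le_compl_comm.1 h.1, by rw [h.2, add_comm]⟩

theorem swap_right (h : IsUnitTriple x y w) : IsUnitTriple x w y := by
  refine ⟨?_, ?_⟩
  · rw [h.2, compl_compl]
    exact le_self_add _ _
  · rw [h.2, add_compl_add_compl h.1, compl_compl]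

theorem rotate (h : IsUnitTriple x y w) : IsUnitTriple y w x :=
  h.swap.swap_right

theorem add_eq (h : IsUnitTriple x y w) : x + y = wᶜ := by
  rw [h.2, compl_compl]

/-- The doubled triple when the first member is at least one half. -/
theorem double_of_large (h : IsUnitTriple x y w) (hx : xᶜ ≤ x) :
    IsUnitTriple (xᶜ + xᶜ)ᶜ (y + y) (w + w) := by
  have e : y + w = xᶜ := h.rotate.add_eq
  have o : y ≤ wᶜ := h.rotate.1
  have hx' : xᶜ ≤ xᶜᶜ := by rwa [compl_compl]
  suffices H : IsUnitTriple (w + w) (y + y) (xᶜ + xᶜ)ᶜ from H.swap.rotate.rotate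
  refine ⟨?_, ?_⟩
  · have hw : w ≤ xᶜ := e ▸ le_add_self _ _
    have hy : y ≤ xᶜ := e ▸ le_self_add _ _
    have h1 : w + w ≤ yᶜ :=
      orthogonal_assoc o (e.le.trans (hx'.trans (compl_anti hw)))
    have h2 : (w + w) + y ≤ yᶜ := by
      have := orthogonal_assoc (x := y) (y := w) (z := xᶜ) o (e.le.trans hx')
      rwa [← e, add_comm y, ← add_assoc] at this
    exact le_compl_comm.1 (orthogonal_assoc h1 h2)
  · rw [← e]
    congr 1
    abel

/-- When all members are at most one half, the new triple is `(1-2x, 1-2y, 1-2w)`, of sum `3-2 = 1`.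
The assumption `x ≤ y` provides the difference `k = y - x`; then `1-2x = k+w` and `w = k+(1-2y)`, so
`(1-2x)+(1-2y) = w+w`. -/
theorem double_of_small_of_le (h : IsUnitTriple x y w) (hx : x ≤ xᶜ) (hy : y ≤ yᶜ) (hw : w ≤ wᶜ)
    (hxy : x ≤ y) : IsUnitTriple (x + x)ᶜ (y + y)ᶜ (w + w)ᶜ := by
  have oab : (x + x)ᶜ ≤ y + y := by
    have h1 : w ≤ x + y := by rw [h.add_eq]; exact hw
    have h2 : (x + y) + (x + y) = 1 := by
      refine le_antisymm (le_one _) ?_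
      rw [← add_compl (x + y), ← h.2]
      exact add_mono le_rfl h1
    rw [le_def, compl_compl, ← h2]
    abel
  refine ⟨by rwa [compl_compl], ?_⟩
  congr 1
  have ea : x + (x + x)ᶜ = y + w := by rw [add_compl_add_compl hx, h.rotate.add_eq]
  have eb : y + (y + y)ᶜ = x + w := by rw [add_compl_add_compl hy, h.swap_right.add_eq]
  set a := (x + x)ᶜ with ha
  set b := (y + y)ᶜ with hb
  have oxa : x ≤ aᶜ := by rw [ha, compl_compl]; exact le_self_add _ _
  have oyb : y ≤ bᶜ := by rw [hb, compl_compl]; exact le_self_add _ _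
  have eyk : x + (x + yᶜ)ᶜ = y := add_compl_add hxy
  set k := (x + yᶜ)ᶜ with hk
  have oxk : x ≤ kᶜ := by rw [hk, compl_compl]; exact le_self_add _ _
  have a_eq : a = k + w := by
    refine add_left_cancel' oxa ?_ ?_
    · refine le_compl_comm.1 (orthogonal_assoc oxk ?_)
      rw [eyk]
      exact h.rotate.1
    · rw [ea, ← eyk, add_assoc]
  have w_eq : w = k + b := by
    refine add_left_cancel' h.swap_right.1 ?_ ?_
    · refine le_compl_comm.1 (orthogonal_assoc oxk ?_)
      rw [eyk]
      exact oyb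
    · rw [← eb, ← add_assoc, eyk]
  rw [a_eq]
  nth_rewrite 2 [w_eq]
  abel

end IsUnitTriple

/-- Additivity in symmetric form. Either some member is at least one half or all are at most one
half; in both cases doubling yields another unit triple with twice the error, up to sign. -/
theorem binaryValue_triple (htot : ∀ x y : C, x ≤ y ∨ y ≤ x) (h01 : (0 : C) ≠ 1) {x y w : C}
    (h : IsUnitTriple x y w) : binaryValue x + binaryValue y + binaryValue w = 1 := by
  have key : ∀ (n : ℕ) (x y w : C), IsUnitTriple x y w →
      |binaryValue x + binaryValue y + binaryValue w - 1| ≤ 2 * (1 / 2) ^ n := by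
    intro n
    induction n with
    -- Three values in `[0,1]` have sum minus one in `[-1,2]`, whence the constant `2`.
    | zero =>
      intro x y w _
      have := binaryValue_nonneg x
      have := binaryValue_le_one x
      have := binaryValue_nonneg y
      have := binaryValue_le_one y
      have := binaryValue_nonneg w
      have := binaryValue_le_one w
      rw [abs_le]
      constructor <;> norm_num <;> linarith
    | succ n ih =>
      -- This includes `x = xᶜ`, where the digit is `1` but both sides equal `1`.
      have small : ∀ x : C, x ≤ xᶜ → 2 * binaryValue x = binaryValue (x + x) := by
        intro x hx
        by_cases h : xᶜ ≤ x
        · have e : xᶜ = x := le_antisymm h hx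
          have h1 := binaryValue_compl htot h01 x
          rw [e] at h1
          have h2 : x + x = 1 := by
            nth_rewrite 2 [← e]
            exact add_compl x
          rw [h2, binaryValue_one]
          linarith
        · exact two_mul_binaryValue_of_not h
      have large : ∀ x y w : C, IsUnitTriple x y w → xᶜ ≤ x →
          |binaryValue x + binaryValue y + binaryValue w - 1| ≤ 2 * (1 / 2) ^ (n + 1) := by
        intro x y w h hx
        have hy : y ≤ yᶜ := (le_compl_comm.1 h.1).trans (hx.trans h.1)
        have hw : w ≤ wᶜ :=
          (le_compl_comm.1 h.swap_right.1).trans (hx.trans h.swap_right.1)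
        have := ih _ _ _ (h.double_of_large hx)
        rw [show binaryValue x + binaryValue y + binaryValue w - 1 =
          (binaryValue (xᶜ + xᶜ)ᶜ + binaryValue (y + y) + binaryValue (w + w) - 1) * (1 / 2) by
            linarith [small y hy, small w hw, two_mul_binaryValue_of_compl_le hx], abs_mul,
          pow_succ, ← mul_assoc, abs_of_pos (by norm_num : (0 : ℝ) < 1 / 2)]
        gcongr
      have small_le : ∀ x y w : C, IsUnitTriple x y w → x ≤ xᶜ → y ≤ yᶜ → w ≤ wᶜ → x ≤ y →
          |binaryValue x + binaryValue y + binaryValue w - 1| ≤ 2 * (1 / 2) ^ (n + 1) := by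
        intro x y w h hx hy hw hxy
        have := ih _ _ _ (h.double_of_small_of_le hx hy hw hxy)
        simp only [binaryValue_compl htot h01] at this
        rw [show binaryValue x + binaryValue y + binaryValue w - 1 =
          -((1 - binaryValue (x + x) + (1 - binaryValue (y + y)) + (1 - binaryValue (w + w)) - 1)
            * (1 / 2)) by
            linarith [small x hx, small y hy, small w hw], abs_neg, abs_mul,
          pow_succ, ← mul_assoc, abs_of_pos (by norm_num : (0 : ℝ) < 1 / 2)]
        gcongr
      intro x y w h
      rcases htot xᶜ x with hx | hx
      · exact large x y w h hx
      rcases htot yᶜ y with hy | hy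
      · rw [add_comm (binaryValue x)]
        exact large y x w h.swap hy
      rcases htot wᶜ w with hw | hw
      · rw [add_comm _ (binaryValue w), ← add_assoc]
        exact large w x y h.rotate.rotate hw
      rcases htot x y with hxy | hxy
      · exact small_le x y w h hx hy hw hxy
      · rw [add_comm (binaryValue x)]
        exact small_le y x w h.swap hy hx hw hxy
  have := eq_zero_of_abs_le_half_pow fun n => key n x y w h
  linarith

theorem binaryValue_add (htot : ∀ x y : C, x ≤ y ∨ y ≤ x) (h01 : (0 : C) ≠ 1) (x y : C) :
    binaryValue (x + y) = min (binaryValue x + binaryValue y) 1 := by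
  have key : ∀ x y : C, x ≤ yᶜ → binaryValue (x + y) = binaryValue x + binaryValue y := by
    intro x y h
    have h1 := binaryValue_triple htot h01 (⟨h, rfl⟩ : IsUnitTriple x y (x + y)ᶜ)
    rw [binaryValue_compl htot h01] at h1
    linarith
  rcases htot x yᶜ with h | h
  · rw [key x y h, min_eq_left]
    rw [← key x y h]
    exact binaryValue_le_one _
  · have h1 : x + y = 1 := by
      rw [le_def, compl_compl, add_comm] at h
      exact h
    have h2 : binaryValue yᶜ ≤ binaryValue x := by
      rw [← add_compl_add h, key]
      · linarith [binaryValue_nonneg (yᶜ + xᶜ)ᶜ]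
      · rw [compl_compl]
        exact le_self_add _ _
    rw [binaryValue_compl htot h01] at h2
    rw [h1, binaryValue_one, min_eq_right]
    linarith

end Triple

end MVAlgebra

/-! ### EMV-homomorphisms and relative complements in the unit interval -/

theorem IsEMVHom.monotone {M₁ M₂ : Type*} [EMVAlgebra M₁] [EMVAlgebra M₂] {f : M₁ → M₂}
    (hf : IsEMVHom f) : Monotone f := fun x y h => by
  rw [← sup_eq_right.2 h, hf.map_sup]
  exact le_sup_left

theorem IsEMVHom.comp {M₁ M₂ M₃ : Type*} [EMVAlgebra M₁] [EMVAlgebra M₂] [EMVAlgebra M₃]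
    {g : M₂ → M₃} {f : M₁ → M₂} (hg : IsEMVHom g) (hf : IsEMVHom f) : IsEMVHom (g ∘ f) where
  map_sup x y := by simp only [Function.comp, hf.map_sup, hg.map_sup]
  map_inf x y := by simp only [Function.comp, hf.map_inf, hg.map_inf]
  map_add x y := by simp only [Function.comp, hf.map_add, hg.map_add]
  map_zero := by simp only [Function.comp, hf.map_zero, hg.map_zero]
  map_relCompl b x z hb hx hz :=
    hg.map_relCompl _ _ _ (by rw [← hf.map_add, hb])
      ⟨EMVAlgebra.zero_le' _, hf.monotone hx.2⟩ (hf.map_relCompl b x z hb hx hz)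

namespace unitInterval

theorem eq_zero_or_one_of_idempotent {a : unitInterval} (ha : a + a = a) : a = 0 ∨ a = 1 := by
  have h := congrArg Subtype.val ha
  rw [coe_truncAdd] at h
  rcases le_total ((a : ℝ) + a) 1 with h' | h'
  · rw [min_eq_left h'] at h
    left
    apply Subtype.ext
    change (a : ℝ) = 0
    linarith
  · rw [min_eq_right h'] at h
    exact Or.inr (Subtype.ext h.symm)

theorem one_add_one : (1 : unitInterval) + 1 = 1 := Subtype.ext (by
  rw [coe_truncAdd]
  exact min_eq_right (by norm_num))

theorem isRelCompl_iff {b x z : unitInterval} (hb : b + b = b) (hx : x ≤ b) :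
    IsRelCompl b x z ↔ (z : ℝ) = b - x := by
  have add_coe : ∀ z : unitInterval, z ≤ b →
      ((z + x : unitInterval) : ℝ) = min ((z : ℝ) + x) b := by
    intro z hz
    rw [coe_truncAdd]
    rcases eq_zero_or_one_of_idempotent hb with rfl | rfl
    · rw [le_antisymm hx x.2.1, le_antisymm hz z.2.1]
      change min ((0 : ℝ) + 0) 1 = min (0 + 0) 0
      norm_num
    · rfl
  have hx' : (x : ℝ) ≤ b := hx
  have key : ∀ z : unitInterval, (z : ℝ) = b - x → IsRelCompl b x z := by
    intro z hz
    have hzb : z ≤ b := by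
      change (z : ℝ) ≤ b
      linarith [x.2.1]
    refine ⟨⟨⟨z.2.1, hzb⟩, Subtype.ext ?_⟩, ?_⟩
    · rw [add_coe z hzb, hz, sub_add_cancel, min_self]
    · rintro w ⟨⟨-, hw⟩, hwx⟩
      have h := congrArg Subtype.val hwx
      rw [add_coe w hw] at h
      change (z : ℝ) ≤ w
      rw [hz]
      linarith [min_le_left ((w : ℝ) + x) b]
  refine ⟨fun h => ?_, key z⟩
  let w : unitInterval := ⟨b - x, by linarith, by linarith [b.2.2, x.2.1]⟩
  rw [h.unique (key w rfl)]

theorem continuous_truncAdd : Continuous fun p : unitInterval × unitInterval => p.1 + p.2 := by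
  apply Continuous.subtype_mk
    (f := fun p : unitInterval × unitInterval => min ((p.1 : ℝ) + p.2) 1)
  fun_prop

end unitInterval

/-! ### States of an MV-algebra form a compact Hausdorff space -/

namespace MVAlgebra

variable {N : Type*} [MVAlgebra N]

open unitInterval

/-- State-morphisms of an MV-algebra are the maps preserving `⊕` and the complement. -/
theorem isState_iff (s : N → unitInterval) :
    (IsEMVHom s ∧ ∃ x, s x = 1) ↔
      (∀ x y, s (x + y) = s x + s y) ∧ ∀ x, s xᶜ = unitInterval.symm (s x) := by
  constructor
  · rintro ⟨hs, x, hx⟩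
    refine ⟨hs.map_add, fun y => ?_⟩
    have h1 : s 1 = 1 := le_antisymm (s 1).2.2 (hx ▸ hs.monotone (le_one x))
    have h := hs.map_relCompl 1 y yᶜ (add_one 1) ⟨zero_le y, le_one y⟩ (by
      rw [isRelCompl_iff (le_one y), compl_one, add_zero])
    rw [h1, unitInterval.isRelCompl_iff one_add_one (s y).2.2] at h
    exact Subtype.ext h
  · rintro ⟨hadd, hcompl⟩
    have hc : ∀ x, (s xᶜ : ℝ) = 1 - s x := fun x => by rw [hcompl, unitInterval.coe_symm_eq]
    have ha : ∀ x y, (s (x + y) : ℝ) = min ((s x : ℝ) + s y) 1 := fun x y => by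
      rw [hadd, coe_truncAdd]
    have h1 : s 1 = 1 := Subtype.ext (by
      rw [← add_compl (0 : N), ha, hc]
      exact min_eq_right (by linarith))
    have h0 : s 0 = 0 := Subtype.ext (by
      rw [← compl_one, hc, h1]
      exact sub_self _)
    have hsup : ∀ x y, s (x ⊔ y) = s x ⊔ s y := by
      intro x y
      apply Subtype.ext
      have e : ((s x ⊔ s y : unitInterval) : ℝ) = max (s x : ℝ) (s y) :=
        Subtype.mono_coe _ |>.map_max
      have := (s x).2.2
      have := (s y).2.2
      rw [e, sup_def, ha, hc, ha, hc]
      rcases le_total (s x : ℝ) (s y) with h | h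
      · rw [max_eq_right h, min_eq_left (by linarith : (s x : ℝ) + (1 - s y) ≤ 1),
          min_eq_left (by linarith)]
        ring
      · rw [max_eq_left h, min_eq_right (by linarith : (1 : ℝ) ≤ s x + (1 - s y)),
          min_eq_left (by linarith)]
        ring
    have hinf : ∀ x y, s (x ⊓ y) = s x ⊓ s y := by
      intro x y
      apply Subtype.ext
      have e : ((s x ⊓ s y : unitInterval) : ℝ) = min (s x : ℝ) (s y) :=
        Subtype.mono_coe _ |>.map_min
      have e' : ((s xᶜ ⊔ s yᶜ : unitInterval) : ℝ) = max (s xᶜ : ℝ) (s yᶜ) :=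
        Subtype.mono_coe _ |>.map_max
      rw [e, inf_def, hc, hsup, e', hc, hc, max_sub_sub_left, sub_sub_cancel]
    refine ⟨⟨hsup, hinf, hadd, h0, fun b x z hb hx hz => ?_⟩, 1, h1⟩
    have hb' : s b + s b = s b := by rw [← hadd, hb]
    have hx' : s x ≤ s b := by
      rw [← sup_eq_right.2 hx.2, hsup]
      exact le_sup_left
    have hx'' : (s x : ℝ) ≤ s b := hx'
    rw [unitInterval.isRelCompl_iff hb' hx', (isRelCompl_iff hx.2).1 hz, hc, ha, hc,
      min_eq_left (by linarith)]
    ring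

/-- The existential `s x = 1` is not visibly closed; `isState_iff` replaces it by equations between
continuous functions of the coordinates. -/
theorem isClosed_isState :
    IsClosed {s : N → unitInterval | IsEMVHom s ∧ ∃ x, s x = 1} := by
  simp only [isState_iff, ofPred_and, ofPred_forall]
  refine IsClosed.inter (isClosed_iInter fun x => isClosed_iInter fun y => ?_)
    (isClosed_iInter fun x => ?_)
  · exact isClosed_eq (continuous_apply _)
      (continuous_truncAdd.comp (f := fun s : N → unitInterval => (s x, s y)) (by fun_prop))
  · exact isClosed_eq (continuous_apply _)
      (unitInterval.continuous_symm.comp (continuous_apply x))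

theorem compactSpace_stateMorphism : CompactSpace (StateMorphism N) :=
  isCompact_iff_compactSpace.1 (isClosed_isState (N := N)).isCompact

end MVAlgebra

namespace StateMorphism

variable {M : Type*} [EMVAlgebra M]

theorem isInducing_val : IsInducing (fun s : StateMorphism M => (s : M → unitInterval)) :=
  IsInducing.subtypeVal

theorem continuous_eval (x : M) : Continuous fun s : StateMorphism M => s x :=
  (continuous_apply x).comp isInducing_val.continuous

theorem ext {s t : StateMorphism M} (h : ∀ x, s x = t x) : s = t :=
  Subtype.ext (funext h)

instance : T2Space (StateMorphism M) :=
  inferInstanceAs (T2Space {s : M → unitInterval // IsEMVHom s ∧ ∃ x, s x = 1})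

end StateMorphism

/-! ### Maximal ideals of an MV-algebra are kernels of states -/

namespace MVAlgebra

variable {N : Type*} [MVAlgebra N]

theorem _root_.IsEMVIdeal.zero_mem {M : Type*} [EMVAlgebra M] {I : Set M} (hI : IsEMVIdeal I) :
    0 ∈ I := by
  obtain ⟨x, hx⟩ := hI.nonempty
  exact hI.mem_of_le _ _ (EMVAlgebra.zero_le' x) hx

theorem _root_.IsEMVIdeal.nsmul_mem {M : Type*} [EMVAlgebra M] {I : Set M} (hI : IsEMVIdeal I)
    {x : M} (hx : x ∈ I) (n : ℕ) : n • x ∈ I := by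
  induction n with
  | zero => rw [zero_nsmul]; exact hI.zero_mem
  | succ n ih => rw [succ_nsmul]; exact hI.add_mem _ _ ih hx

theorem _root_.IsEMVIdeal.eq_univ_iff {I : Set N} (hI : IsEMVIdeal I) :
    I = univ ↔ (1 : N) ∈ I :=
  ⟨fun h => h ▸ mem_univ _, fun h => eq_univ_of_forall fun x => hI.mem_of_le _ _ (le_one x) h⟩

theorem isEMVIdeal_Iic {b : N} (hb : b + b = b) : IsEMVIdeal (Iic b) where
  nonempty := ⟨b, le_refl b⟩
  mem_of_le _ _ h h' := le_trans h h'
  add_mem x y hx hy := by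
    change x + y ≤ b
    rw [← hb]
    exact add_mono hx hy

/-- Zorn's lemma above `Iic b`, which is already an ideal since `b` is idempotent. -/
theorem exists_isMaximalEMVIdeal {b : N} (hb : b + b = b) (hb1 : b ≠ 1) :
    ∃ A : Set N, IsMaximalEMVIdeal A ∧ b ∈ A := by
  obtain ⟨A, hbA, hA⟩ := zorn_subset_nonempty {I : Set N | IsEMVIdeal I ∧ (1 : N) ∉ I} (by
    intro c hc hch hne
    refine ⟨⋃₀ c, ⟨⟨?_, ?_, ?_⟩, ?_⟩, fun s hs => subset_sUnion_of_mem hs⟩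
    · obtain ⟨I, hI⟩ := hne
      exact ⟨0, I, hI, (hc hI).1.zero_mem⟩
    · rintro x y hxy ⟨I, hI, hy⟩
      exact ⟨I, hI, (hc hI).1.mem_of_le x y hxy hy⟩
    · rintro x y ⟨I, hI, hx⟩ ⟨J, hJ, hy⟩
      rcases hch.total hI hJ with h | h
      · exact ⟨J, hJ, (hc hJ).1.add_mem x y (h hx) hy⟩
      · exact ⟨I, hI, (hc hI).1.add_mem x y hx (h hy)⟩
    · rintro ⟨I, hI, h1⟩
      exact (hc hI).2 h1) (Iic b)
    ⟨isEMVIdeal_Iic hb, fun h => hb1 (le_antisymm (le_one b) h)⟩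
  refine ⟨A, ⟨hA.prop.1, fun h => hA.prop.2 (h ▸ mem_univ _), fun J hJ hJ1 hAJ => ?_⟩,
    hbA (le_refl b)⟩
  exact (hA.eq_of_subset ⟨hJ, fun h => hJ1 (hJ.eq_univ_iff.2 h)⟩ hAJ).symm

theorem _root_.IsMaximalEMVIdeal.one_notMem {A : Set N} (hA : IsMaximalEMVIdeal A) :
    (1 : N) ∉ A := fun h => hA.ne_univ (hA.isEMVIdeal.eq_univ_iff.2 h)

/-- If `u ∉ A`, then `A` and `u` generate everything, so `1 ≤ a + n • u` with `a ∈ A`; meeting with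
`v` kills `n • u` and gives `v ≤ a`. -/
theorem _root_.IsMaximalEMVIdeal.mem_or_mem {A : Set N} (hA : IsMaximalEMVIdeal A) {u v : N}
    (h : v ⊓ u = 0) : u ∈ A ∨ v ∈ A := by
  by_contra! hne
  obtain ⟨hu, hv⟩ := hne
  have hI := hA.isEMVIdeal
  let J : Set N := {x | ∃ a ∈ A, ∃ n : ℕ, x ≤ a + n • u}
  have hJ : IsEMVIdeal J := by
    refine ⟨⟨0, 0, hI.zero_mem, 0, zero_le _⟩, ?_, ?_⟩
    · rintro x y hxy ⟨a, ha, n, hy⟩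
      exact ⟨a, ha, n, le_trans hxy hy⟩
    · rintro x y ⟨a, ha, n, hx⟩ ⟨a', ha', n', hy⟩
      refine ⟨a + a', hI.add_mem _ _ ha ha', n + n', (add_mono hx hy).trans (le_of_eq ?_)⟩
      rw [add_nsmul]
      abel
  have hAJ : A ⊆ J := fun a ha => ⟨a, ha, 0, by rw [zero_nsmul, add_zero]⟩
  by_cases hJ1 : J = univ
  · obtain ⟨a, ha, n, h1⟩ := hJ.eq_univ_iff.1 hJ1
    refine hv (hI.mem_of_le v a ?_ ha)
    calc v = v ⊓ (a + n • u) := (inf_eq_left.2 ((le_one v).trans h1)).symm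
      _ ≤ v ⊓ a + v ⊓ n • u := inf_add_le _ _ _
      _ = v ⊓ a := by rw [inf_nsmul_eq_zero h, add_zero]
      _ ≤ a := inf_le_right
  · rw [← hA.eq_of_subset J hJ hJ1 hAJ] at hu
    exact hu ⟨0, hI.zero_mem, 1, by rw [one_nsmul, zero_add]⟩

theorem tsub_triangle (x y z : N) : (xᶜ + z)ᶜ ≤ (xᶜ + y)ᶜ + (yᶜ + z)ᶜ := by
  rw [tsub_le_iff]
  have h1 : x ≤ y + (xᶜ + y)ᶜ := tsub_le_iff.1 le_rfl
  have h2 : y ≤ z + (yᶜ + z)ᶜ := tsub_le_iff.1 le_rfl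
  refine h1.trans ((add_mono h2 le_rfl).trans (le_of_eq ?_))
  abel

theorem add_tsub_add_le (x y x' y' : N) :
    ((x + x')ᶜ + (y + y'))ᶜ ≤ (xᶜ + y)ᶜ + (x'ᶜ + y')ᶜ := by
  rw [tsub_le_iff]
  have h1 : x ≤ y + (xᶜ + y)ᶜ := tsub_le_iff.1 le_rfl
  have h2 : x' ≤ y' + (x'ᶜ + y')ᶜ := tsub_le_iff.1 le_rfl
  refine (add_mono h1 h2).trans (le_of_eq ?_)
  abel

/-- The congruence of an ideal of an MV-algebra. -/
def idealCon {A : Set N} (hA : IsEMVIdeal A) : AddCon N where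
  r x y := (xᶜ + y)ᶜ ∈ A ∧ (yᶜ + x)ᶜ ∈ A
  iseqv := by
    refine ⟨fun x => ?_, fun h => ⟨h.2, h.1⟩, fun {x y z} h h' => ⟨?_, ?_⟩⟩
    · rw [add_comm, add_compl, compl_one]
      exact ⟨hA.zero_mem, hA.zero_mem⟩
    · exact hA.mem_of_le _ _ (tsub_triangle x y z) (hA.add_mem _ _ h.1 h'.1)
    · exact hA.mem_of_le _ _ (tsub_triangle z y x) (hA.add_mem _ _ h'.2 h.2)
  add' h h' := ⟨hA.mem_of_le _ _ (add_tsub_add_le _ _ _ _) (hA.add_mem _ _ h.1 h'.1),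
    hA.mem_of_le _ _ (add_tsub_add_le _ _ _ _) (hA.add_mem _ _ h.2 h'.2)⟩

theorem idealCon_iff {A : Set N} (hA : IsEMVIdeal A) {x y : N} :
    idealCon hA x y ↔ (xᶜ + y)ᶜ ∈ A ∧ (yᶜ + x)ᶜ ∈ A := Iff.rfl

theorem idealCon_compl {A : Set N} (hA : IsEMVIdeal A) {x y : N} (h : idealCon hA x y) :
    idealCon hA xᶜ yᶜ := by
  rw [idealCon_iff] at *
  rw [compl_compl, compl_compl, add_comm x, add_comm y]
  exact ⟨h.2, h.1⟩

/-- The quotient of an MV-algebra by an ideal. -/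
abbrev IdealQuotient {A : Set N} (hA : IsEMVIdeal A) : Type _ := (idealCon hA).Quotient

instance {A : Set N} (hA : IsEMVIdeal A) : MVAlgebra (IdealQuotient hA) where
  one := ((1 : N) : IdealQuotient hA)
  compl := Quotient.map compl fun _ _ h => idealCon_compl hA h
  compl_zero := congrArg _ (compl_zero (N := N))
  compl_compl x := by
    induction x using AddCon.induction_on with
    | H x => exact congrArg _ (compl_compl x)
  add_one x := by
    induction x using AddCon.induction_on with
    | H x => exact congrArg _ (add_one x)
  luk x y := by
    induction x using AddCon.induction_on with
    | H x =>
      induction y using AddCon.induction_on with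
      | H y => exact congrArg _ (luk x y)

theorem idealQuotient_eq_one_iff {A : Set N} (hA : IsEMVIdeal A) (x : N) :
    (x : IdealQuotient hA) = 1 ↔ xᶜ ∈ A := by
  change (x : IdealQuotient hA) = ((1 : N) : IdealQuotient hA) ↔ _
  rw [AddCon.eq, idealCon_iff, add_one, compl_one, zero_add]
  exact ⟨fun h => h.2, fun h => ⟨hA.zero_mem, h⟩⟩

/-- Primality applied to `x ⊖ y` and `y ⊖ x` makes the quotient a chain, and the state is its
`binaryValue`. Injectivity on the quotient need not be checked: the kernel is a proper ideal
containing `A`, hence equal to `A`. -/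
theorem exists_state_of_isMaximalEMVIdeal {A : Set N} (hA : IsMaximalEMVIdeal A) :
    ∃ t : StateMorphism N, ∀ x, t x = 0 ↔ x ∈ A := by
  have hI := hA.isEMVIdeal
  have htot : ∀ x y : IdealQuotient hI, x ≤ y ∨ y ≤ x := by
    intro x y
    induction x using AddCon.induction_on with
    | H x =>
      induction y using AddCon.induction_on with
      | H y =>
        rcases hA.mem_or_mem (tsub_inf_tsub x y) with h | h
        · right
          exact (idealQuotient_eq_one_iff hI (yᶜ + x)).2 h
        · left
          exact (idealQuotient_eq_one_iff hI (xᶜ + y)).2 h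
  have h01 : (0 : IdealQuotient hI) ≠ 1 := by
    intro h
    have := (idealQuotient_eq_one_iff hI 0).1 h
    rw [compl_zero] at this
    exact hA.one_notMem this
  let t : N → unitInterval := fun x =>
    ⟨binaryValue (x : IdealQuotient hI), binaryValue_nonneg _, binaryValue_le_one _⟩
  have htadd : ∀ x y, t (x + y) = t x + t y := fun x y =>
    Subtype.ext (binaryValue_add htot h01 (x : IdealQuotient hI) y)
  have htcompl : ∀ x, t xᶜ = unitInterval.symm (t x) := fun x =>
    Subtype.ext (binaryValue_compl htot h01 (x : IdealQuotient hI))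
  have ht := (isState_iff t).2 ⟨htadd, htcompl⟩
  have hker : IsEMVIdeal {x | t x = 0} := by
    refine ⟨⟨0, ht.1.map_zero⟩, fun x y hxy hy => ?_, fun x y hx hy => ?_⟩
    · exact le_antisymm (hy ▸ ht.1.monotone hxy) (t x).2.1
    · change t (x + y) = 0
      rw [htadd, hx, hy, add_zero]
  have hone : t 1 = 1 := Subtype.ext binaryValue_one
  have hsub : A ⊆ {x | t x = 0} := by
    intro x hx
    have h : ((xᶜ : N) : IdealQuotient hI) = 1 :=
      (idealQuotient_eq_one_iff hI xᶜ).2 (by rwa [compl_compl])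
    have h1 : t xᶜ = 1 := Subtype.ext (by
      change binaryValue ((xᶜ : N) : IdealQuotient hI) = 1
      rw [h, binaryValue_one])
    rw [htcompl] at h1
    exact unitInterval.symm_eq_one.1 h1
  have hne : {x | t x = 0} ≠ univ := fun h => by
    have h0 : t 1 = 0 := hker.eq_univ_iff.1 h
    rw [hone] at h0
    exact one_ne_zero h0
  have := hA.eq_of_subset _ hker hne hsub
  exact ⟨⟨t, ht⟩, fun x => by rw [← this]; rfl⟩

end MVAlgebra

/-! ### Ideals, idempotents and states of an EMV-algebra -/

theorem EMVAlgebra.isEMVIdeal_Iic {M : Type*} [EMVAlgebra M] {b : M} (hb : b + b = b) :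
    IsEMVIdeal (Iic b) where
  nonempty := ⟨b, le_refl b⟩
  mem_of_le _ _ h h' := le_trans h h'
  add_mem x y hx hy := by
    obtain ⟨lam, -, h⟩ := EMVAlgebra.interval_mv b hb
    exact (h.op_mem x ⟨EMVAlgebra.zero_le' x, hx⟩ y ⟨EMVAlgebra.zero_le' y, hy⟩).2

theorem IsEMVIdeal.exists_idempotent_notMem {M : Type*} [EMVAlgebra M] {J : Set M}
    (hJ : IsEMVIdeal J) (h : J ≠ univ) : ∃ b : M, b + b = b ∧ b ∉ J := by
  by_contra! hne
  refine h (eq_univ_of_forall fun x => ?_)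
  obtain ⟨b, hb, hxb⟩ := EMVAlgebra.exists_idempotent_ge x
  exact hJ.mem_of_le x b hxb (hne b hb)

theorem IsEMVIdeal.preimage {M N : Type*} [EMVAlgebra M] [EMVAlgebra N] {f : M → N}
    (hf : IsEMVHom f) {I : Set N} (hI : IsEMVIdeal I) : IsEMVIdeal (f ⁻¹' I) where
  nonempty := ⟨0, by
    rw [mem_preimage, hf.map_zero]
    exact hI.zero_mem⟩
  mem_of_le _ _ h h' := hI.mem_of_le _ _ (hf.monotone h) h'
  add_mem x y hx hy := by
    rw [mem_preimage, hf.map_add]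
    exact hI.add_mem _ _ hx hy

theorem IsEMVHom.le_iff {M N : Type*} [EMVAlgebra M] [EMVAlgebra N] {f : M → N}
    (hf : IsEMVHom f) (hinj : Function.Injective f) {x y : M} : f x ≤ f y ↔ x ≤ y := by
  refine ⟨fun h => ?_, fun h => hf.monotone h⟩
  rw [← sup_eq_right, ← hf.map_sup] at h
  exact sup_eq_right.1 (hinj h)

theorem noncompactSpace_of_directed_open_cover {X ι : Type*} [TopologicalSpace X] [Nonempty ι]
    (U : ι → Set X) (ho : ∀ j, IsOpen (U j)) (hc : ∀ x, ∃ j, x ∈ U j)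
    (hd : Directed (· ⊆ ·) U) (hne : ∀ j, U j ≠ univ) : NoncompactSpace X := by
  refine ⟨fun h => ?_⟩
  obtain ⟨j, hj⟩ := h.elim_directed_cover U ho (fun x _ => mem_iUnion.2 (hc x)) hd
  exact hne j (univ_subset_iff.1 hj)

theorem EMVAlgebra.exists_idempotent_ge_both {M : Type*} [EMVAlgebra M] (a b : M) :
    ∃ c : M, c + c = c ∧ a ≤ c ∧ b ≤ c := by
  obtain ⟨c, hc, h⟩ := EMVAlgebra.exists_idempotent_ge (a ⊔ b)
  exact ⟨c, hc, le_sup_left.trans h, le_sup_right.trans h⟩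

namespace StateMorphism

variable {M : Type*} [EMVAlgebra M]

theorem monotone (s : StateMorphism M) : Monotone s.1 := s.2.1.monotone

theorem exists_idempotent (s : StateMorphism M) : ∃ b : M, b + b = b ∧ s b = 1 := by
  obtain ⟨x, hx⟩ := s.2.2
  obtain ⟨b, hb, hxb⟩ := EMVAlgebra.exists_idempotent_ge x
  exact ⟨b, hb, le_antisymm (s b).2.2 (hx.ge.trans (s.monotone hxb))⟩

theorem apply_idempotent (s : StateMorphism M) {b : M} (hb : b + b = b) : s b = 0 ∨ s b = 1 :=
  unitInterval.eq_zero_or_one_of_idempotent (by rw [← s.2.1.map_add, hb])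

theorem coe_nsmul (s : StateMorphism M) (x : M) (n : ℕ) :
    (s (n • x) : ℝ) = min (n * (s x : ℝ)) 1 := by
  induction n with
  | zero =>
    rw [zero_nsmul, s.2.1.map_zero, Nat.cast_zero, zero_mul]
    exact (min_eq_left zero_le_one).symm
  | succ n ih =>
    have := (s x).2.1
    rw [succ_nsmul, s.2.1.map_add, unitInterval.coe_truncAdd, ih, Nat.cast_succ, add_mul, one_mul]
    rcases le_total (n * (s x : ℝ)) 1 with h | h
    · rw [min_eq_left h]
    · rw [min_eq_right h, min_eq_right (by linarith), min_eq_right (by linarith)]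

/-- The kernel of a state-morphism. -/
def ker (s : StateMorphism M) : Set M := {x | s x = 0}

theorem isEMVIdeal_ker (s : StateMorphism M) : IsEMVIdeal s.ker where
  nonempty := ⟨0, s.2.1.map_zero⟩
  mem_of_le _ _ h h' := le_antisymm ((s.monotone h).trans (le_of_eq h')) (unitInterval.nonneg _)
  add_mem x y hx hy := by
    change s.1 (x + y) = 0
    rw [s.2.1.map_add, show s.1 x = 0 from hx, show s.1 y = 0 from hy, add_zero]

end StateMorphism

/-! ### The hull-kernel topology; `MaxI N` is compact Hausdorff -/

theorem MaxI.ext {M : Type*} [EMVAlgebra M] {A B : MaxI M} (h : A.carrier = B.carrier) :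
    A = B := by
  cases A; cases B; cases h; rfl

theorem MaxI.isOpen_not_subset {M : Type*} [EMVAlgebra M] {I : Set M} (hI : IsEMVIdeal I) :
    IsOpen {A : MaxI M | ¬ I ⊆ A.carrier} :=
  TopologicalSpace.isOpen_generateFrom_of_mem ⟨I, hI, rfl⟩

theorem MaxI.isOpen_notMem_idempotent {M : Type*} [EMVAlgebra M] {b : M} (hb : b + b = b) :
    IsOpen {A : MaxI M | b ∉ A.carrier} := by
  convert MaxI.isOpen_not_subset (EMVAlgebra.isEMVIdeal_Iic hb) using 4 with A
  exact ⟨fun h x hx => A.isMaximal.isEMVIdeal.mem_of_le x b hx h, fun h => h (le_refl b)⟩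

namespace MVAlgebra

variable {N : Type*} [MVAlgebra N]

theorem state_compl (s : StateMorphism N) (x : N) : s xᶜ = unitInterval.symm (s x) :=
  ((isState_iff s.1).1 s.2).2 x

theorem state_one (s : StateMorphism N) : s (1 : N) = 1 := by
  rw [← compl_zero, state_compl, s.2.1.map_zero, unitInterval.symm_zero]

/-- If `s x > 0`, some multiple has `s (n • x) = 1`, so `(n • x)ᶜ` is in the kernel, and an ideal
containing the kernel and `x` contains `1`. -/
theorem isMaximalEMVIdeal_ker (s : StateMorphism N) : IsMaximalEMVIdeal s.ker := by
  refine ⟨s.isEMVIdeal_ker, fun h => ?_, fun J hJ hJ1 hsub => ?_⟩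
  · have h0 : s (1 : N) = 0 := s.isEMVIdeal_ker.eq_univ_iff.1 h
    rw [state_one] at h0
    exact one_ne_zero h0
  · refine Subset.antisymm (fun x hx => ?_) hsub
    by_contra hne
    have hpos : 0 < (s x : ℝ) := lt_of_le_of_ne (s x).2.1 fun h => hne (Subtype.ext h.symm)
    obtain ⟨n, hn⟩ := Archimedean.arch (1 : ℝ) hpos
    rw [nsmul_eq_mul] at hn
    have h1 : s (n • x) = 1 := Subtype.ext (by rw [s.coe_nsmul]; exact min_eq_right hn)
    have h2 : (n • x)ᶜ ∈ J := hsub (by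
      change s (n • x)ᶜ = 0
      rw [state_compl, h1, unitInterval.symm_one])
    refine hJ1 (hJ.eq_univ_iff.2 ?_)
    rw [← add_compl (n • x)]
    exact hJ.add_mem _ _ (hJ.nsmul_mem hx n) h2

theorem isOpen_notMem (x : N) : IsOpen {A : MaxI N | x ∉ A.carrier} := by
  have hI : IsEMVIdeal {y : N | ∃ n : ℕ, y ≤ n • x} := by
    refine ⟨⟨0, 0, zero_le _⟩, ?_, ?_⟩
    · rintro y z hyz ⟨n, hz⟩
      exact ⟨n, le_trans hyz hz⟩
    · rintro y z ⟨n, hy⟩ ⟨m, hz⟩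
      exact ⟨n + m, by rw [add_nsmul]; exact add_mono hy hz⟩
  convert MaxI.isOpen_not_subset hI using 4 with A
  refine ⟨?_, fun h => h ⟨1, by rw [one_nsmul]⟩⟩
  rintro h y ⟨n, hy⟩
  exact A.isMaximal.isEMVIdeal.mem_of_le _ _ hy (A.isMaximal.isEMVIdeal.nsmul_mem h n)

/-- For `x ∈ A \ B` and `y ∈ B \ A`, the difference `y ⊖ x` is outside `A` and `x ⊖ y` outside `B`;
these differences have meet `0`, so no maximal ideal avoids both. -/
theorem t2Space_maxI : T2Space (MaxI N) := by
  refine ⟨fun A B hAB => ?_⟩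
  have hA := A.isMaximal
  have hB := B.isMaximal
  obtain ⟨x, hxA, hxB⟩ : ∃ x ∈ A.carrier, x ∉ B.carrier := by
    by_contra! h
    exact hAB (MaxI.ext (hA.eq_of_subset _ hB.isEMVIdeal hB.ne_univ h).symm)
  obtain ⟨y, hyB, hyA⟩ : ∃ y ∈ B.carrier, y ∉ A.carrier := by
    by_contra! h
    exact hAB (MaxI.ext (hB.eq_of_subset _ hA.isEMVIdeal hA.ne_univ h))
  refine ⟨_, _, isOpen_notMem (yᶜ + x)ᶜ, isOpen_notMem (xᶜ + y)ᶜ, fun h => hyA ?_,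
    fun h => hxB ?_, ?_⟩
  · exact hA.isEMVIdeal.mem_of_le _ _ (tsub_le_iff.1 le_rfl) (hA.isEMVIdeal.add_mem _ _ hxA h)
  · exact hB.isEMVIdeal.mem_of_le _ _ (tsub_le_iff.1 le_rfl) (hB.isEMVIdeal.add_mem _ _ hyB h)
  · rw [Set.disjoint_left]
    intro C h h'
    exact (C.isMaximal.mem_or_mem (tsub_inf_tsub x y)).elim h h'

theorem compactSpace_maxI : CompactSpace (MaxI N) := by
  have := compactSpace_stateMorphism (N := N)
  let k : StateMorphism N → MaxI N := fun s => ⟨s.ker, isMaximalEMVIdeal_ker s⟩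
  have hk : Continuous k := by
    refine continuous_generateFrom_iff.2 ?_
    rintro _ ⟨I, -, rfl⟩
    have e : k ⁻¹' {A : MaxI N | ¬ I ⊆ A.carrier} =
        ⋃ x ∈ I, {s : StateMorphism N | s x ≠ 0} := by
      ext s
      simp only [mem_preimage, mem_ofPred_eq, not_subset, mem_iUnion, exists_prop]
      rfl
    rw [e]
    exact isOpen_biUnion fun x _ => isOpen_ne_fun (StateMorphism.continuous_eval x)
      continuous_const
  have hsurj : Function.Surjective k := fun A => by
    obtain ⟨t, ht⟩ := exists_state_of_isMaximalEMVIdeal A.isMaximal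
    exact ⟨t, MaxI.ext (Set.ext ht)⟩
  exact hsurj.compactSpace hk

end MVAlgebra

/-! ### Maximal ideals of `M` and of `N` -/

section Embedding

open MVAlgebra

variable {M N : Type*} [EMVAlgebra M] [MVAlgebra N]

/-- An EMV-algebra represented as a maximal ideal of an MV-algebra consisting of the elements
of the ideal and their complements. -/
structure IsMaximalEmbedding (i : M → N) : Prop where
  hom : IsEMVHom i
  injective : Function.Injective i
  maximal : IsMaximalEMVIdeal (range i)
  mem_or_compl_mem : ∀ y : N, y ∈ range i ∨ yᶜ ∈ range i

namespace IsMaximalEmbedding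

variable {i : M → N}

theorem map_idempotent (hi : IsMaximalEmbedding i) {b : M} (hb : b + b = b) : i b + i b = i b := by
  rw [← hi.hom.map_add, hb]

theorem isEMVIdeal_image (hi : IsMaximalEmbedding i)
    {J : Set M} (hJ : IsEMVIdeal J) : IsEMVIdeal (i '' J) where
  nonempty := hJ.nonempty.image i
  mem_of_le := by
    rintro x _ h ⟨y, hy, rfl⟩
    obtain ⟨x, rfl⟩ := hi.maximal.isEMVIdeal.mem_of_le x (i y) h ⟨y, rfl⟩
    exact ⟨x, hJ.mem_of_le x y ((hi.hom.le_iff hi.injective).1 h) hy, rfl⟩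
  add_mem := by
    rintro _ _ ⟨x, hx, rfl⟩ ⟨y, hy, rfl⟩
    exact ⟨x + y, hJ.add_mem x y hx hy, hi.hom.map_add x y⟩

theorem inf_mem_range (hi : IsMaximalEmbedding i) (y : N) (b : M) : y ⊓ i b ∈ range i :=
  hi.maximal.isEMVIdeal.mem_of_le _ (i b) inf_le_right ⟨b, rfl⟩

theorem isEMVIdeal_extend (hi : IsMaximalEmbedding i)
    {J : Set M} (hJ : IsEMVIdeal J) {b : M} (hb : b + b = b) :
    IsEMVIdeal {y : N | y ⊓ i b ∈ i '' J} := by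
  have h := hi.isEMVIdeal_image hJ
  refine ⟨⟨0, ?_⟩, fun x y hxy hy => ?_, fun x y hx hy => ?_⟩
  · exact h.mem_of_le _ _ inf_le_left h.zero_mem
  · exact h.mem_of_le _ _ (inf_le_inf_right _ hxy) hy
  · change (x + y) ⊓ i b ∈ i '' J
    rw [add_inf_of_idempotent (hi.map_idempotent hb)]
    exact h.add_mem _ _ hx hy

theorem apply_mem_extend (hi : IsMaximalEmbedding i)
    {J : Set M} (hJ : IsEMVIdeal J) (b : M) {x : M} (hx : x ∈ J) :
    i x ⊓ i b ∈ i '' J :=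
  (hi.isEMVIdeal_image hJ).mem_of_le _ _ inf_le_left ⟨x, hx, rfl⟩

theorem apply_notMem_extend (hi : IsMaximalEmbedding i) {J : Set M} {b : M} (hbJ : b ∉ J) :
    i b ∉ {y : N | y ⊓ i b ∈ i '' J} := by
  intro h
  rw [mem_ofPred_eq, inf_idem, hi.injective.mem_set_image] at h
  exact hbJ h

theorem preimage_eq_of_isMaximal (hi : IsMaximalEmbedding i)
    {J : Set M} (hJ : IsMaximalEMVIdeal J) {b : M} {K : Set N}
    (hK : IsEMVIdeal K) (hbK : i b ∉ K) (hJK : J ⊆ i ⁻¹' K) : i ⁻¹' K = J :=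
  hJ.eq_of_subset _ (hK.preimage hi.hom) (fun h => hbK (h ▸ mem_univ b : b ∈ i ⁻¹' K)) hJK

/-- The extended ideal contains `(i b)ᶜ`, so a proper `K` above it omits `i b`. Then `K` restricts
to a proper ideal above `J`, hence to `J`, and `x ∈ K` forces `x ⊓ i b` into the image of `J`. -/
theorem isMaximal_extend (hi : IsMaximalEmbedding i)
    {J : Set M} (hJ : IsMaximalEMVIdeal J) {b : M} (hb : b + b = b)
    (hbJ : b ∉ J) : IsMaximalEMVIdeal {y : N | y ⊓ i b ∈ i '' J} := by
  have hE := hi.isEMVIdeal_extend hJ.isEMVIdeal hb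
  refine ⟨hE, fun h => hi.apply_notMem_extend hbJ (h ▸ mem_univ _), fun K hK hK1 hsub => ?_⟩
  refine Subset.antisymm (fun x hx => ?_) hsub
  have hbK : i b ∉ K := by
    intro h
    refine hK1 (hK.eq_univ_iff.2 ?_)
    rw [← add_compl (i b)]
    refine hK.add_mem _ _ h (hsub ?_)
    rw [mem_ofPred_eq, inf_compl_of_idempotent (hi.map_idempotent hb)]
    exact (hi.isEMVIdeal_image hJ.isEMVIdeal).zero_mem
  have hKJ := hi.preimage_eq_of_isMaximal hJ hK hbK
    fun x hx => hsub (hi.apply_mem_extend hJ.isEMVIdeal b hx)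
  obtain ⟨z, hz⟩ := hi.inf_mem_range x b
  refine ⟨z, ?_, hz⟩
  rw [← hKJ, mem_preimage, hz]
  exact hK.mem_of_le _ _ inf_le_left hx

theorem exists_notMem (hi : IsMaximalEmbedding i)
    {K : Set N} (hK : IsMaximalEMVIdeal K) (hne : K ≠ range i) :
    ∃ b : M, b + b = b ∧ i b ∉ K := by
  refine (hK.isEMVIdeal.preimage hi.hom).exists_idempotent_notMem fun h => hne ?_
  refine hi.maximal.eq_of_subset K hK.isEMVIdeal hK.ne_univ ?_
  rintro _ ⟨x, rfl⟩
  exact (h ▸ mem_univ x : x ∈ i ⁻¹' K)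

theorem subset_extend (hi : IsMaximalEmbedding i)
    {K : Set N} (hK : IsEMVIdeal K) {J : Set M} (hJ : i ⁻¹' K ⊆ J) (b : M) :
    K ⊆ {y : N | y ⊓ i b ∈ i '' J} := by
  intro y hy
  obtain ⟨z, hz⟩ := hi.inf_mem_range y b
  refine ⟨z, hJ ?_, hz⟩
  rw [mem_preimage, hz]
  exact hK.mem_of_le _ _ inf_le_left hy

/-- A proper `J` above the restriction omits some idempotent `c`; its extension along `c` is proper
and contains `K`, so equals `K`, and therefore `J` lies in the restriction. -/
theorem isMaximal_preimage (hi : IsMaximalEmbedding i)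
    {K : Set N} (hK : IsMaximalEMVIdeal K) (hne : K ≠ range i) :
    IsMaximalEMVIdeal (i ⁻¹' K) := by
  obtain ⟨b, -, hb⟩ := hi.exists_notMem hK hne
  refine ⟨hK.isEMVIdeal.preimage hi.hom, fun h => hb (h ▸ mem_univ b : b ∈ i ⁻¹' K),
    fun J hJ hJ1 hsub => ?_⟩
  obtain ⟨c, hc, hcJ⟩ := hJ.exists_idempotent_notMem hJ1
  have h := hK.eq_of_subset _ (hi.isEMVIdeal_extend hJ hc)
    (fun h => hi.apply_notMem_extend hcJ (h ▸ mem_univ _)) (hi.subset_extend hK.isEMVIdeal hsub c)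
  refine Subset.antisymm (fun x hx => ?_) hsub
  rw [mem_preimage, ← h]
  exact hi.apply_mem_extend hJ c hx

/-- A maximal ideal of the MV-algebra containing a given idempotent of the EMV-algebra, other than
the EMV-algebra itself. -/
theorem exists_isMaximal_ne_range (hi : IsMaximalEmbedding i)
    (hM : ¬ ∃ t : M, ∀ x : M, x ≤ t) {b : M} (hb : b + b = b) :
    ∃ A : Set N, IsMaximalEMVIdeal A ∧ i b ∈ A ∧ A ≠ range i := by
  push Not at hM
  obtain ⟨x, hx⟩ := hM b
  obtain ⟨c, hc, hxc⟩ := EMVAlgebra.exists_idempotent_ge x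
  -- Since `c` is not below `b`, the idempotent `cᶜ + b` is not `1`. A maximal ideal containing it
  -- contains `b` and `cᶜ`, hence omits `c`.
  have hy : ((i c)ᶜ + i b) + ((i c)ᶜ + i b) = (i c)ᶜ + i b := by
    rw [add_add_add_comm, compl_idempotent (hi.map_idempotent hc), hi.map_idempotent hb]
  have hy1 : (i c)ᶜ + i b ≠ 1 := fun h =>
    hx (hxc.trans ((hi.hom.le_iff hi.injective).1 (le_def.2 h)))
  obtain ⟨A, hA, hyA⟩ := exists_isMaximalEMVIdeal hy hy1
  refine ⟨A, hA, hA.isEMVIdeal.mem_of_le _ _ (le_add_self _ _) hyA, ?_⟩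
  rintro rfl
  refine hA.one_notMem ?_
  rw [← add_compl (i c)]
  exact hA.isEMVIdeal.add_mem _ _ ⟨c, rfl⟩ (hA.isEMVIdeal.mem_of_le _ _ (le_self_add _ _) hyA)

theorem exists_extend (hi : IsMaximalEmbedding i)
    (J : MaxI M) : ∃ K : MaxI N, i ⁻¹' K.carrier = J.carrier ∧
    ∃ b : M, K.carrier = {y : N | y ⊓ i b ∈ i '' J.carrier} ∧ b ∉ J.carrier := by
  obtain ⟨b, hb, hbJ⟩ :=
    J.isMaximal.isEMVIdeal.exists_idempotent_notMem J.isMaximal.ne_univ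
  exact ⟨⟨_, hi.isMaximal_extend J.isMaximal hb hbJ⟩, hi.preimage_eq_of_isMaximal J.isMaximal
    (hi.isEMVIdeal_extend J.isMaximal.isEMVIdeal hb) (hi.apply_notMem_extend hbJ)
    (fun x hx => hi.apply_mem_extend J.isMaximal.isEMVIdeal b hx), b, rfl, hbJ⟩

/-- The maximal ideal of the MV-algebra lying over a maximal ideal of the EMV-algebra. -/
noncomputable def extend (hi : IsMaximalEmbedding i) (J : MaxI M) : MaxI N :=
  (hi.exists_extend J).choose

theorem preimage_extend (hi : IsMaximalEmbedding i)
    (J : MaxI M) : i ⁻¹' (hi.extend J).carrier = J.carrier :=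
  (hi.exists_extend J).choose_spec.1

/-- This matches the subbasic open sets of the two hull-kernel topologies: ideals of `N` restrict to
`M`, and ideals of `M` have images that are ideals of `N`. -/
theorem subset_extend_iff (hi : IsMaximalEmbedding i) {I : Set N} (hI : IsEMVIdeal I) (J : MaxI M) :
    I ⊆ (hi.extend J).carrier ↔ i ⁻¹' I ⊆ J.carrier := by
  constructor
  · intro h
    rw [← hi.preimage_extend J]
    exact preimage_mono h
  · intro h
    obtain ⟨b, hb, -⟩ := (hi.exists_extend J).choose_spec.2
    rw [extend, hb]
    exact hi.subset_extend hI h b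

theorem range_extend (hi : IsMaximalEmbedding i) : range hi.extend = {⟨range i, hi.maximal⟩}ᶜ := by
  ext K
  rw [mem_compl_iff, mem_singleton_iff]
  constructor
  · rintro ⟨J, rfl⟩ h
    refine J.isMaximal.ne_univ ?_
    rw [← hi.preimage_extend J, h]
    exact preimage_range i
  · intro h
    have hne : K.carrier ≠ range i := fun h' => h (MaxI.ext h')
    refine ⟨⟨_, hi.isMaximal_preimage K.isMaximal hne⟩, MaxI.ext ?_⟩
    exact K.isMaximal.eq_of_subset _ (hi.extend _).isMaximal.isEMVIdeal
      (hi.extend _).isMaximal.ne_univ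
      ((hi.subset_extend_iff K.isMaximal.isEMVIdeal _).2 Subset.rfl)

theorem isEmbedding_extend (hi : IsMaximalEmbedding i) : IsEmbedding hi.extend := by
  refine ⟨⟨?_⟩, fun J J' h => MaxI.ext ?_⟩
  · change TopologicalSpace.generateFrom _ = TopologicalSpace.induced _
      (TopologicalSpace.generateFrom _)
    rw [induced_generateFrom_eq]
    congr 1
    ext U
    constructor
    · rintro ⟨I, hI, rfl⟩
      refine ⟨_, ⟨i '' I, hi.isEMVIdeal_image hI, rfl⟩, ?_⟩
      ext J
      rw [mem_preimage, mem_ofPred_eq, mem_ofPred_eq,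
        hi.subset_extend_iff (hi.isEMVIdeal_image hI), preimage_image_eq _ hi.injective]
    · rintro ⟨_, ⟨I, hI, rfl⟩, rfl⟩
      refine ⟨i ⁻¹' I, hI.preimage hi.hom, ?_⟩
      ext J
      rw [mem_preimage, mem_ofPred_eq, mem_ofPred_eq, hi.subset_extend_iff hI]
  · rw [← hi.preimage_extend J, h, hi.preimage_extend J']

theorem noncompactSpace_maxI (hi : IsMaximalEmbedding i)
    (hM : ¬ ∃ t : M, ∀ x : M, x ≤ t) : NoncompactSpace (MaxI M) := by
  have : Nonempty {b : M // b + b = b} := ⟨0, add_zero 0⟩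
  refine noncompactSpace_of_directed_open_cover
    (fun b : {b : M // b + b = b} => {J : MaxI M | b.1 ∉ J.carrier})
    (fun b => MaxI.isOpen_notMem_idempotent b.2) (fun J => ?_) (fun b c => ?_) (fun b h => ?_)
  · obtain ⟨b, hb, hbJ⟩ :=
      J.isMaximal.isEMVIdeal.exists_idempotent_notMem J.isMaximal.ne_univ
    exact ⟨⟨b, hb⟩, hbJ⟩
  · obtain ⟨d, hd, hbd, hcd⟩ := EMVAlgebra.exists_idempotent_ge_both b.1 c.1
    exact ⟨⟨d, hd⟩, fun J h h' => h (J.isMaximal.isEMVIdeal.mem_of_le _ _ hbd h'),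
      fun J h h' => h (J.isMaximal.isEMVIdeal.mem_of_le _ _ hcd h')⟩
  · obtain ⟨A, hA, hbA, hne⟩ := hi.exists_isMaximal_ne_range hM b.2
    have hJ : (⟨_, hi.isMaximal_preimage hA hne⟩ : MaxI M) ∈
        {J : MaxI M | b.1 ∉ J.carrier} := h ▸ mem_univ _
    exact hJ hbA

/-! ### State-morphisms of `M` and of `N` -/

theorem state_ext (hi : IsMaximalEmbedding i)
    {s t : StateMorphism N} (h : ∀ x, s (i x) = t (i x)) : s = t := by
  refine StateMorphism.ext fun y => ?_
  rcases hi.mem_or_compl_mem y with ⟨x, rfl⟩ | ⟨x, hx⟩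
  · exact h x
  · rw [← compl_compl y, ← hx, state_compl, state_compl, h]

theorem exists_extendState (hi : IsMaximalEmbedding i) (s : StateMorphism M) :
    ∃ t : StateMorphism N, ∀ x, t (i x) = s x := by
  obtain ⟨b, hb, hsb⟩ := s.exists_idempotent
  have hib := hi.map_idempotent hb
  -- `p y` is `y ⊓ i b` read in `M`; the extension is `s ∘ p`.
  choose p hp using fun y => hi.inf_mem_range y b
  refine ⟨⟨fun y => s (p y), (isState_iff _).2 ⟨fun x y => ?_, fun x => ?_⟩⟩, fun x => ?_⟩
  · rw [← s.2.1.map_add]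
    refine congrArg s.1 (hi.injective ?_)
    rw [hi.hom.map_add, hp, hp, hp, add_inf_of_idempotent hib]
  · have hpb : ∀ y, p y ∈ Icc 0 b := fun y => by
      refine ⟨EMVAlgebra.zero_le' _, (hi.hom.le_iff hi.injective).1 ?_⟩
      rw [hp]
      exact inf_le_right
    obtain ⟨lam, hlam, -⟩ := EMVAlgebra.interval_mv b hb
    have h := hlam (p x) (hpb x)
    have h1 := hi.hom.map_relCompl _ _ _ hb (hpb x) h
    rw [isRelCompl_iff (hi.hom.monotone (hpb x).2), hp,
      ← compl_inf_of_idempotent hib, ← hp] at h1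
    -- `p xᶜ` is the complement of `p x` relative to `b`, and `s` preserves this with `s b = 1`.
    rw [hi.injective h1] at h
    have h2 := s.2.1.map_relCompl _ _ _ hb (hpb x) h
    rw [hsb, unitInterval.isRelCompl_iff unitInterval.one_add_one (unitInterval.le_one _)] at h2
    exact Subtype.ext h2
  · change s.1 (p (i x)) = s.1 x
    have e : p (i x) = x ⊓ b := hi.injective (by rw [hp, hi.hom.map_inf])
    rw [e, s.2.1.map_inf, hsb]
    exact inf_eq_left.2 (unitInterval.le_one _)

/-- The state-morphism of the MV-algebra extending a state-morphism of the EMV-algebra. -/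
noncomputable def extendState (hi : IsMaximalEmbedding i) (s : StateMorphism M) :
    StateMorphism N := (hi.exists_extendState s).choose

theorem extendState_apply (hi : IsMaximalEmbedding i)
    (s : StateMorphism M) (x : M) : hi.extendState s (i x) = s x :=
  (hi.exists_extendState s).choose_spec x

theorem exists_stateInfty (hi : IsMaximalEmbedding i) : ∃ t : StateMorphism N,
    (∀ y ∈ range i, t y = 0) ∧ ∀ y ∉ range i, t y = 1 := by
  classical
  have hR := hi.maximal.isEMVIdeal
  have one_add : ∀ u : unitInterval, 1 + u = 1 := fun u => Subtype.ext (by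
    rw [unitInterval.coe_truncAdd]
    exact min_eq_right (by simpa using u.2.1))
  refine ⟨⟨fun y => if y ∈ range i then 0 else 1, (isState_iff _).2
    ⟨fun x y => ?_, fun x => ?_⟩⟩, fun y hy => if_pos hy, fun y hy => if_neg hy⟩
  · by_cases hx : x ∈ range i
    · by_cases hy : y ∈ range i
      · rw [if_pos hx, if_pos hy, if_pos (hR.add_mem _ _ hx hy), add_zero]
      · rw [if_pos hx, if_neg hy, zero_add,
          if_neg fun h => hy (hR.mem_of_le _ _ (le_add_self _ _) h)]
    · rw [if_neg hx, one_add, if_neg fun h => hx (hR.mem_of_le _ _ (le_self_add _ _) h)]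
  · by_cases hx : x ∈ range i
    · rw [if_pos hx, unitInterval.symm_zero, if_neg]
      intro h
      refine hi.maximal.one_notMem ?_
      rw [← add_compl x]
      exact hR.add_mem _ _ hx h
    · rw [if_neg hx, unitInterval.symm_one, if_pos ((hi.mem_or_compl_mem x).resolve_left hx)]

/-- A state is `0` or `1` on each idempotent. If it vanished on all idempotents of `M`, it would
vanish on `M`, since they dominate `M`, and so equal `t₀`. -/
theorem exists_idempotent_apply_eq_one (hi : IsMaximalEmbedding i)
    {t t₀ : StateMorphism N} (h₀ : ∀ y ∈ range i, t₀ y = 0)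
    (hne : t ≠ t₀) : ∃ b : M, b + b = b ∧ t (i b) = 1 := by
  by_contra! h
  refine hne (hi.state_ext fun x => ?_)
  obtain ⟨b, hb, hxb⟩ := EMVAlgebra.exists_idempotent_ge x
  have hb0 : t (i b) = 0 :=
    (t.apply_idempotent (hi.map_idempotent hb)).resolve_right (h b hb)
  rw [h₀ _ ⟨x, rfl⟩]
  exact t.isEMVIdeal_ker.mem_of_le _ _ (hi.hom.monotone hxb) hb0

/-- The restriction of a state-morphism that does not vanish on the EMV-algebra. -/
theorem exists_restrict (hi : IsMaximalEmbedding i)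
    {t t₀ : StateMorphism N} (h₀ : ∀ y ∈ range i, t₀ y = 0)
    (hne : t ≠ t₀) : ∃ s : StateMorphism M, ∀ x, s x = t (i x) := by
  obtain ⟨b, -, hb⟩ := hi.exists_idempotent_apply_eq_one h₀ hne
  exact ⟨⟨t.1 ∘ i, t.2.1.comp hi.hom, b, hb⟩, fun _ => rfl⟩

theorem range_extendState (hi : IsMaximalEmbedding i)
    {t₀ : StateMorphism N} (h₀ : ∀ y ∈ range i, t₀ y = 0) :
    range hi.extendState = {t₀}ᶜ := by
  ext t
  rw [mem_compl_iff, mem_singleton_iff]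
  constructor
  · rintro ⟨s, rfl⟩ h
    obtain ⟨b, -, hb⟩ := s.exists_idempotent
    rw [← hi.extendState_apply, h, h₀ _ ⟨b, rfl⟩] at hb
    exact zero_ne_one hb
  · intro h
    obtain ⟨s, hs⟩ := hi.exists_restrict h₀ h
    exact ⟨s, hi.state_ext fun x => by rw [hi.extendState_apply, hs]⟩

theorem isEmbedding_extendState (hi : IsMaximalEmbedding i) : IsEmbedding hi.extendState := by
  refine ⟨?_, fun s t h => StateMorphism.ext fun x => ?_⟩
  · have hcont : Continuous hi.extendState := by
      refine StateMorphism.isInducing_val.continuous_iff.2 (continuous_pi fun y => ?_)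
      rcases hi.mem_or_compl_mem y with ⟨x, rfl⟩ | ⟨x, hx⟩
      · simpa only [Function.comp_def, hi.extendState_apply] using StateMorphism.continuous_eval x
      · have e : ∀ s, hi.extendState s y = unitInterval.symm (s x) := fun s => by
          rw [← hi.extendState_apply, hx, state_compl, unitInterval.symm_symm]
        simpa only [Function.comp_def, e] using
          unitInterval.continuous_symm.comp (StateMorphism.continuous_eval x)
    -- Restricting to `M` after extending gives the inclusion of the states of `M` in the product,
    -- which is inducing.
    refine IsInducing.of_comp hcont
      (g := fun (t : StateMorphism N) (x : M) => t (i x))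
      (continuous_pi fun x => StateMorphism.continuous_eval (i x)) ?_
    have e : (fun (t : StateMorphism N) (x : M) => t (i x)) ∘ hi.extendState =
        fun s : StateMorphism M => (s : M → unitInterval) :=
      funext fun s => funext fun x => hi.extendState_apply s x
    rw [e]
    exact StateMorphism.isInducing_val
  · rw [← hi.extendState_apply s, h, hi.extendState_apply]

theorem noncompactSpace_stateMorphism (hi : IsMaximalEmbedding i) (hM : ¬ ∃ t : M, ∀ x : M, x ≤ t) :
    NoncompactSpace (StateMorphism M) := by
  have : Nonempty {b : M // b + b = b} := ⟨0, add_zero 0⟩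
  refine noncompactSpace_of_directed_open_cover
    (fun b : {b : M // b + b = b} => {s : StateMorphism M | s b.1 ≠ 0})
    (fun b => isOpen_ne_fun (StateMorphism.continuous_eval b.1) continuous_const)
    (fun s => ?_) (fun b c => ?_) (fun b h => ?_)
  · obtain ⟨b, hb, hsb⟩ := s.exists_idempotent
    exact ⟨⟨b, hb⟩, by rw [mem_ofPred_eq, hsb]; exact one_ne_zero⟩
  · obtain ⟨d, hd, hbd, hcd⟩ := EMVAlgebra.exists_idempotent_ge_both b.1 c.1
    exact ⟨⟨d, hd⟩, fun s h h' => h (s.isEMVIdeal_ker.mem_of_le _ _ hbd h'),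
      fun s h h' => h (s.isEMVIdeal_ker.mem_of_le _ _ hcd h')⟩
  · obtain ⟨A, hA, hbA, hne⟩ := hi.exists_isMaximal_ne_range hM b.2
    obtain ⟨t, ht⟩ := exists_state_of_isMaximalEMVIdeal hA
    obtain ⟨t₀, h₀, -⟩ := hi.exists_stateInfty
    -- The kernel `A` of `t` differs from `M`, so `t` restricts to a state of `M`; it vanishes at
    -- `b`.
    obtain ⟨s, hs⟩ := hi.exists_restrict (t := t) h₀ (by
      rintro rfl
      exact hne (hi.maximal.eq_of_subset A hA.isEMVIdeal hA.ne_univ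
        fun y hy => (ht y).1 (h₀ y hy)))
    have hmem : s ∈ {s : StateMorphism M | s b.1 ≠ 0} := h ▸ mem_univ s
    exact hmem (by rw [hs]; exact (ht _).2 hbA)

end IsMaximalEmbedding

end Embedding

/-! ### The one-point compactifications -/

theorem locallyCompactSpace_of_isEmbedding_of_range_eq {X Y : Type*} [TopologicalSpace X]
    [TopologicalSpace Y] [T2Space Y] [CompactSpace Y] {f : X → Y} (hf : IsEmbedding f) {y : Y}
    (hy : range f = {y}ᶜ) : LocallyCompactSpace X :=
  IsOpenEmbedding.locallyCompactSpace (f := f) ⟨hf, hy ▸ isOpen_compl_singleton⟩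

/-- `M` is an EMV-algebra without top element, embedded by `i` as a maximal ideal into the
MV-algebra `N` in such a way that `N` consists of the elements of `M` and their complements. -/
theorem mainTheorem3 {M N : Type*} [EMVAlgebra M] [MVAlgebra N]
    (hM : ¬ ∃ t : M, ∀ x : M, x ≤ t)
    (i : M → N) (hi : IsEMVHom i) (hinj : Function.Injective i)
    (hmax : IsMaximalEMVIdeal (Set.range i))
    (hrep : ∀ y : N, y ∈ Set.range i ∨ yᶜ ∈ Set.range i) :
    (T2Space (StateMorphism M) ∧ LocallyCompactSpace (StateMorphism M) ∧
      NoncompactSpace (StateMorphism M) ∧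
      T2Space (StateMorphism N) ∧ CompactSpace (StateMorphism N) ∧
      ∃ h : OnePoint (StateMorphism M) ≃ₜ StateMorphism N,
        (∀ (s : StateMorphism M) (x : M),
          h (s : OnePoint (StateMorphism M)) (i x) = s x ∧
          ((h (s : OnePoint (StateMorphism M)) (i x)ᶜ : unitInterval) : ℝ) = 1 - (s x : ℝ)) ∧
        (∀ y ∈ Set.range i, h OnePoint.infty y = 0) ∧
        (∀ y ∉ Set.range i, h OnePoint.infty y = 1)) ∧
    (T2Space (MaxI M) ∧ LocallyCompactSpace (MaxI M) ∧ NoncompactSpace (MaxI M) ∧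
      T2Space (MaxI N) ∧ CompactSpace (MaxI N) ∧
      ∃ g : OnePoint (MaxI M) ≃ₜ MaxI N,
        (∀ J : MaxI M, i ⁻¹' (g (J : OnePoint (MaxI M))).carrier = J.carrier) ∧
        (g OnePoint.infty).carrier = Set.range i) := by
  have hE : IsMaximalEmbedding i := ⟨hi, hinj, hmax, hrep⟩
  obtain ⟨t₀, h₀, h₁⟩ := hE.exists_stateInfty
  have := MVAlgebra.compactSpace_stateMorphism (N := N)
  have := MVAlgebra.compactSpace_maxI (N := N)
  have := MVAlgebra.t2Space_maxI (N := N)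
  have eS := hE.isEmbedding_extendState
  have rS := hE.range_extendState h₀
  have eI := hE.isEmbedding_extend
  have rI := hE.range_extend
  refine ⟨⟨inferInstance, locallyCompactSpace_of_isEmbedding_of_range_eq eS rS,
    hE.noncompactSpace_stateMorphism hM, inferInstance, inferInstance,
    OnePoint.equivOfIsEmbeddingOfRangeEq _ _ eS rS, fun s x => ⟨?_, ?_⟩, h₀, h₁⟩,
    eI.t2Space, locallyCompactSpace_of_isEmbedding_of_range_eq eI rI,
    hE.noncompactSpace_maxI hM, inferInstance, inferInstance,
    OnePoint.equivOfIsEmbeddingOfRangeEq _ _ eI rI, fun J => ?_, rfl⟩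
  · exact hE.extendState_apply s x
  · rw [OnePoint.equivOfIsEmbeddingOfRangeEq_apply_coe, MVAlgebra.state_compl,
      hE.extendState_apply, unitInterval.coe_symm_eq]
  · exact hE.preimage_extend J
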